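/- Let $\mathcal X,\mathcal Y$ be finite-dimensional real inner product spaces and consider the saddle point problem $$\min_{x\in\mathcal X}\max_{y\in\mathcal Y}\ \mathcal L(x,y)=f(x)+\Phi(x,y)-g(y).$$ **Assumptions.** (A1) $f:\mathcal X\to\mathbb R\cup\{\infty\}$ and $g:\mathcal Y\to\mathbb R\cup\{\infty\}$ are proper, closed and strongly convex with moduli $\mu_x>0$ and $\mu_y>0$. The function $\Phi:\mathcal X\times\mathcal Y\to\mathbb R$ is such that $\Phi(\cdot,y)$ is convex and differentiable for every $y\in\operatorname{dom}g$, $\Phi(x,\cdot)$ is concave and differentiable for every $x\in\operatorname{dom}f$, and there are $L_{xx},L_{yy}\ge0$, $L_{xy},L_{yx}>0$ such that for all $x,\bar x\in\operatorname{dom}f$ and $y,\bar y\in\operatorname{dom}g$ $$\|\nabla_x\Phi(x,y)-\nabla_x\Phi(\bar x,\bar y)\|\le L_{xx}\|x-\bar x\|+L_{xy}\|y-\bar y\|,\qquad \|\nabla_y\Phi(x,y)-\nabla_y\Phi(\bar x,\bar y)\|\le L_{yx}\|x-\bar x\|+L_{yy}\|y-\bar y\|.$$ (A2) $\operatorname{dom}f\times\operatorname{dom}g$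 is compact, and $\Omega_f,\Omega_g>0$ satisfy $\|x_1-x_2\|^2\le\Omega_f$ on $\operatorname{dom}f$ and $\|y_1-y_2\|^2\le\Omega_g$ on $\operatorname{dom}g$. **Algorithm.** SGDA is SAPD with momentum $\theta=0$. SAPD starts from deterministic $x_0=x_{-1}\in\operatorname{dom}f$, $y_0=y_{-1}\in\operatorname{dom}g$ and, for $k\ge0$, iterates $$\tilde s_k=\tilde\nabla_y\Phi(x_k,y_k;\omega^y_k)+\theta\big(\tilde\nabla_y\Phi(x_k,y_k;\omega^y_k)-\tilde\nabla_y\Phi(x_{k-1},y_{k-1};\omega^y_{k-1})\big),$$ $$y_{k+1}=\operatorname{prox}_{\sigma g}(y_k+\sigma\tilde s_k),\qquad x_{k+1}=\operatorname{prox}_{\tau f}\big(x_k-\tau\tilde\nabla_x\Phi(x_k,y_{k+1};\omega^x_k)\big),$$ where $\operatorname{prox}_h(x)=\arg\min_v h(v)+\frac12\|x-v\|^2$. (A3) The samples $(\omega^x_k)_k$ and $(\omega_k^y)_k$ are sequences of independent random variables, and the two sequences are independent of each other. The oracles are measurable and square integrable along the iterates, and for some $\delta_x,\delta_y\ge0$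 and all $k\ge0$: $\mathbb E[\tilde\nabla_x\Phi(x_k,y_{k+1};\omega^x_k)\mid x_k,y_{k+1}]=\nabla_x\Phi(x_k,y_{k+1})$, $\mathbb E[\tilde\nabla_y\Phi(x_k,y_k;\omega^y_k)\mid x_k,y_k]=\nabla_y\Phi(x_k,y_k)$, $\mathbb E[\|\tilde\nabla_x\Phi(x_k,y_{k+1};\omega^x_k)-\nabla_x\Phi(x_k,y_{k+1})\|^2\mid x_k,y_{k+1}]\le\delta_x^2$ and $\mathbb E[\|\tilde\nabla_y\Phi(x_k,y_k;\omega^y_k)-\nabla_y\Phi(x_k,y_k)\|^2\mid x_k,y_k]\le\delta_y^2$. **Parameters.** Given $\epsilon>0$ and $\beta_1,\beta_2\in(0,1)$ with $\beta_1+\beta_2<1$, put $$L(\beta_1,\beta_2)=\max\Big\{\tfrac{L_{xx}}{\mu_x}+\tfrac1{\beta_1}\tfrac{L_{yx}^2}{\mu_x\mu_y},\ \tfrac1{\beta_2(1-\beta_1-\beta_2)}\tfrac{L_{yy}^2}{\mu_y^2}\Big\},\qquad \overline\rho=\Big(1+\tfrac1{L(\beta_1,\beta_2)}\Big)^{-1},$$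 $$\overline{\overline\rho}_1=\max\Big\{0,\,1-\tfrac{\mu_x}{6\delta_x^2}\epsilon\Big\},\qquad \overline{\overline\rho}_2=\max\Big\{0,\,\tfrac{6\delta_y^2-\epsilon\mu_y}{6\delta_y^2-\epsilon\mu_y(\beta_1+\beta_2)}\Big\},$$ with the convention that $\overline{\overline\rho}_1=0$ if $\delta_x=0$ and $\overline{\overline\rho}_2=0$ if $6\delta_y^2\le\epsilon\mu_y(\beta_1+\beta_2)$ (in particular if $\delta_y=0$). Let $$\rho=\max\{\overline\rho,\overline{\overline\rho}_1,\overline{\overline\rho}_2\},\qquad \tau=\frac{1-\rho}{\mu_x\rho},\qquad \sigma=\frac1{1-\beta_1-\beta_2}\cdot\frac{1-\rho}{\mu_y\rho}.$$ **Proposition.** For all $\beta_1,\beta_2\in(0,1)$ with $\beta_1+\beta_2<1$ there is a constant $C>0$, depending only on $\beta_1$ and $\beta_2$, such that for every problem satisfying (A1) and (A2), every $\epsilon>0$, and every run of SGDA with the above $\tau,\sigma$ satisfying (A3), the weighted averages $$(\bar x_N,\bar y_N)=\Big(\sum_{k=0}^{N-1}\rho^{-k}\Big)^{-1}\sum_{k=1}^N\rho^{-k+1}(x_k,y_k)$$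 satisfy $$\mathcal G(\bar x_N,\bar y_N)=\mathbb E\Big[\sup_{(x,y)\in\mathcal X\times\mathcal Y}\{\mathcal L(\bar x_N,y)-\mathcal L(x,\bar y_N)\}\Big]\le\epsilon$$ for every integer $N\ge1$ with $$N\ \ge\ C\Big(1+\frac{L_{xx}}{\mu_x}+\frac{L_{yx}^2}{\mu_x\mu_y}+\frac{L_{yy}^2}{\mu_y^2}+\Big(\frac{\delta_x^2}{\mu_x}+\frac{\delta_y^2}{\mu_y}\Big)\frac1\epsilon\Big)\cdot\ln\Big(\frac{\mu_x\Omega_f+\mu_y\Omega_g}{\epsilon}+1\Big).$$ That is, SGDA reaches $\mathcal G\le\epsilon$ within the number of iterations $\max\{1,\lceil\cdot\rceil\}$ of the right-hand side. -/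

import Mathlib

open MeasureTheory ProbabilityTheory
open scoped ENNReal

noncomputable section

namespace SaddlePoint

/-! ### The convex-concave saddle point problem `min_x max_y f x + Φ x y - g y` -/

/-- The effective domain of an extended-real-valued function. -/
def effDom {E : Type*} (f : E → EReal) : Set E := {x | f x ≠ ⊤}

/-- `f : E → ℝ ∪ {∞}` is proper, closed (lower semicontinuous) and convex with modulus `m`. -/
structure IsProperClosedConvex {E : Type*} [NormedAddCommGroup E] [InnerProductSpace ℝ E]
    (f : E → EReal) (m : ℝ) : Prop where
  ne_bot : ∀ x, f x ≠ ⊥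
  proper : (effDom f).Nonempty
  closed : LowerSemicontinuous f
  convex : StrongConvexOn (effDom f) m (fun x => (f x).toReal)

/-- The objective `f x + Φ x y - g y`, with values in the extended reals. -/
def lagrangian {E F : Type*} (f : E → EReal) (g : F → EReal) (Φ : E → F → ℝ)
    (x : E) (y : F) : EReal :=
  f x + (Φ x y : EReal) - g y

/-- The partial gradient of `Φ` in its first argument. -/
def gradX {E F : Type*} [NormedAddCommGroup E] [InnerProductSpace ℝ E] [CompleteSpace E]
    (Φ : E → F → ℝ) (x : E) (y : F) : E :=
  gradient (fun u => Φ u y) x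

/-- The partial gradient of `Φ` in its second argument. -/
def gradY {E F : Type*} [NormedAddCommGroup F] [InnerProductSpace ℝ F] [CompleteSpace F]
    (Φ : E → F → ℝ) (x : E) (y : F) : F :=
  gradient (fun v => Φ x v) y

/-- Standing assumption on the problem: `f`, `g` are proper closed convex with moduli `μx`, `μy`;
on the domains `Φ` is convex-concave and differentiable with block-Lipschitz partial gradients. -/
structure IsSmoothSaddle {E F : Type*}
    [NormedAddCommGroup E] [InnerProductSpace ℝ E] [CompleteSpace E]
    [NormedAddCommGroup F] [InnerProductSpace ℝ F] [CompleteSpace F]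
    (f : E → EReal) (g : F → EReal) (Φ : E → F → ℝ)
    (μx μy Lxx Lxy Lyx Lyy : ℝ) : Prop where
  f_convex : IsProperClosedConvex f μx
  g_convex : IsProperClosedConvex g μy
  Lxx_nonneg : 0 ≤ Lxx
  Lxy_pos : 0 < Lxy
  Lyx_pos : 0 < Lyx
  Lyy_nonneg : 0 ≤ Lyy
  convex_x : ∀ y ∈ effDom g, ConvexOn ℝ Set.univ (fun x => Φ x y)
  diff_x : ∀ y ∈ effDom g, Differentiable ℝ (fun x => Φ x y)
  lip_x : ∀ x ∈ effDom f, ∀ x' ∈ effDom f, ∀ y ∈ effDom g, ∀ y' ∈ effDom g,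
    ‖gradX Φ x y - gradX Φ x' y'‖ ≤ Lxx * ‖x - x'‖ + Lxy * ‖y - y'‖
  concave_y : ∀ x ∈ effDom f, ConcaveOn ℝ Set.univ (fun y => Φ x y)
  diff_y : ∀ x ∈ effDom f, Differentiable ℝ (fun y => Φ x y)
  lip_y : ∀ x ∈ effDom f, ∀ x' ∈ effDom f, ∀ y ∈ effDom g, ∀ y' ∈ effDom g,
    ‖gradY Φ x y - gradY Φ x' y'‖ ≤ Lyx * ‖x - x'‖ + Lyy * ‖y - y'‖

/-- The domains are compact, with squared diameters at most `Ωf` and `Ωg`. -/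
structure HasCompactDomains {E F : Type*} [NormedAddCommGroup E] [NormedAddCommGroup F]
    (f : E → EReal) (g : F → EReal) (Ωf Ωg : ℝ) : Prop where
  compact : IsCompact (effDom f ×ˢ effDom g)
  Ωf_pos : 0 < Ωf
  Ωg_pos : 0 < Ωg
  diam_f : ∀ x ∈ effDom f, ∀ x' ∈ effDom f, ‖x - x'‖ ^ 2 ≤ Ωf
  diam_g : ∀ y ∈ effDom g, ∀ y' ∈ effDom g, ‖y - y'‖ ^ 2 ≤ Ωg

/-- The primal-dual gap of a point: the supremum over all `(x, y)` of
`L(xbar, y) - L(x, ybar)`. -/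
def primalDualGap {E F : Type*} (f : E → EReal) (g : F → EReal) (Φ : E → F → ℝ)
    (xbar : E) (ybar : F) : EReal :=
  ⨆ (x : E) (y : F), lagrangian f g Φ xbar y - lagrangian f g Φ x ybar

/-- The gap function: the expected primal-dual gap of a random point. The gap is nonnegative
at every point of the domain, so the expectation is that of a `[0, ∞]`-valued quantity. -/
def expectedGap {E F Ω : Type*} [MeasurableSpace Ω] (P : Measure Ω)
    (f : E → EReal) (g : F → EReal) (Φ : E → F → ℝ) (xbar : Ω → E) (ybar : Ω → F) : ℝ≥0∞ :=
  ∫⁻ w, (primalDualGap f g Φ (xbar w) (ybar w)).toENNReal ∂P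

/-! ### The SAPD algorithm -/

/-- The proximal operator: a minimizer over `v` of `h v + ‖x - v‖² / 2`
(unique when `h` is proper, closed and convex). -/
def prox {E : Type*} [NormedAddCommGroup E] (h : E → EReal) (x : E) : E :=
  Classical.epsilon fun p : E => ∀ v : E,
    h p + ((‖x - p‖ ^ 2 / 2 : ℝ) : EReal) ≤ h v + ((‖x - v‖ ^ 2 / 2 : ℝ) : EReal)

/-- The SAPD recursion along fixed samples `sx`, `sy` of the oracles `Gx`, `Gy`. The value at `k`
is `((x_{k-1}, y_{k-1}), (x_k, y_k))`, where `(x_{-1}, y_{-1}) = (x_0, y_0)`. The momentum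
increment `q` vanishes at `k = 0`, where the truncated index `k - 1` is `0`. -/
def sapdState {E F S T : Type*} [NormedAddCommGroup E] [InnerProductSpace ℝ E]
    [NormedAddCommGroup F] [InnerProductSpace ℝ F]
    (f : E → EReal) (g : F → EReal) (Gx : E → F → S → E) (Gy : E → F → T → F)
    (τ σ θ : ℝ) (x₀ : E) (y₀ : F) (sx : ℕ → S) (sy : ℕ → T) : ℕ → (E × F) × (E × F)
  | 0 => ((x₀, y₀), (x₀, y₀))
  | k + 1 =>
    let prev := (sapdState f g Gx Gy τ σ θ x₀ y₀ sx sy k).1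
    let cur := (sapdState f g Gx Gy τ σ θ x₀ y₀ sx sy k).2
    let q : F := Gy cur.1 cur.2 (sy k) - Gy prev.1 prev.2 (sy (k - 1))
    let s : F := Gy cur.1 cur.2 (sy k) + θ • q
    let yNext : F := prox (fun v => (σ : EReal) * g v) (cur.2 + σ • s)
    let xNext : E := prox (fun v => (τ : EReal) * f v) (cur.1 - τ • Gx cur.1 yNext (sx k))
    (cur, (xNext, yNext))

/-- The primal SAPD iterates `x_k` as random variables. -/
def sapdX {E F S T Ω : Type*} [NormedAddCommGroup E] [InnerProductSpace ℝ E]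
    [NormedAddCommGroup F] [InnerProductSpace ℝ F]
    (f : E → EReal) (g : F → EReal) (Gx : E → F → S → E) (Gy : E → F → T → F)
    (τ σ θ : ℝ) (x₀ : E) (y₀ : F) (ωx : ℕ → Ω → S) (ωy : ℕ → Ω → T) (k : ℕ) (w : Ω) : E :=
  (sapdState f g Gx Gy τ σ θ x₀ y₀ (fun i => ωx i w) (fun i => ωy i w) k).2.1

/-- The dual SAPD iterates `y_k` as random variables. -/
def sapdY {E F S T Ω : Type*} [NormedAddCommGroup E] [InnerProductSpace ℝ E]
    [NormedAddCommGroup F] [InnerProductSpace ℝ F]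
    (f : E → EReal) (g : F → EReal) (Gx : E → F → S → E) (Gy : E → F → T → F)
    (τ σ θ : ℝ) (x₀ : E) (y₀ : F) (ωx : ℕ → Ω → S) (ωy : ℕ → Ω → T) (k : ℕ) (w : Ω) : F :=
  (sapdState f g Gx Gy τ σ θ x₀ y₀ (fun i => ωx i w) (fun i => ωy i w) k).2.2

/-- The weighted average `(∑_{k=1}^N ρ^{-(k-1)} z_k) / (∑_{k=0}^{N-1} ρ^{-k})`. -/
def weightedAvg {E Ω : Type*} [NormedAddCommGroup E] [InnerProductSpace ℝ E]
    (ρ : ℝ) (z : ℕ → Ω → E) (N : ℕ) (w : Ω) : E :=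
  (∑ k ∈ Finset.range N, (ρ ^ k)⁻¹)⁻¹ • ∑ k ∈ Finset.range N, (ρ ^ k)⁻¹ • z (k + 1) w

/-- Stochastic oracle assumption along the random iterates `x`, `y`: measurable oracles, independent
samples, conditionally unbiased estimates with conditional variances at most `δx²`, `δy²`.
The integrability clauses say that the conditional expectations exist. -/
structure IsUnbiasedOracle {E F S T Ω : Type*}
    [NormedAddCommGroup E] [InnerProductSpace ℝ E] [CompleteSpace E]
    [MeasurableSpace E]
    [NormedAddCommGroup F] [InnerProductSpace ℝ F] [CompleteSpace F]
    [MeasurableSpace F]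
    [MeasurableSpace S] [MeasurableSpace T] [MeasurableSpace Ω] (P : Measure Ω)
    (Φ : E → F → ℝ) (Gx : E → F → S → E) (Gy : E → F → T → F)
    (ωx : ℕ → Ω → S) (ωy : ℕ → Ω → T) (x : ℕ → Ω → E) (y : ℕ → Ω → F)
    (δx δy : ℝ) : Prop where
  δx_nonneg : 0 ≤ δx
  δy_nonneg : 0 ≤ δy
  measurable_Gx : Measurable fun p : E × F × S => Gx p.1 p.2.1 p.2.2
  measurable_Gy : Measurable fun p : E × F × T => Gy p.1 p.2.1 p.2.2
  measurable_ωx : ∀ k, Measurable (ωx k)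
  measurable_ωy : ∀ k, Measurable (ωy k)
  indep_ωx : iIndepFun ωx P
  indep_ωy : iIndepFun ωy P
  indep_ωx_ωy : IndepFun (fun w k => ωx k w) (fun w k => ωy k w) P
  integrable_x : ∀ k, Integrable (fun w => Gx (x k w) (y (k + 1) w) (ωx k w)) P
  integrable_y : ∀ k, Integrable (fun w => Gy (x k w) (y k w) (ωy k w)) P
  integrable_sq_x : ∀ k, Integrable (fun w =>
    ‖Gx (x k w) (y (k + 1) w) (ωx k w) - gradX Φ (x k w) (y (k + 1) w)‖ ^ 2) P
  integrable_sq_y : ∀ k, Integrable (fun w =>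
    ‖Gy (x k w) (y k w) (ωy k w) - gradY Φ (x k w) (y k w)‖ ^ 2) P
  unbiased_x : ∀ k,
    P[fun w => Gx (x k w) (y (k + 1) w) (ωx k w) |
      MeasurableSpace.comap (fun w => (x k w, y (k + 1) w)) inferInstance]
    =ᵐ[P] fun w => gradX Φ (x k w) (y (k + 1) w)
  unbiased_y : ∀ k,
    P[fun w => Gy (x k w) (y k w) (ωy k w) |
      MeasurableSpace.comap (fun w => (x k w, y k w)) inferInstance]
    =ᵐ[P] fun w => gradY Φ (x k w) (y k w)
  variance_x : ∀ k,
    P[fun w => ‖Gx (x k w) (y (k + 1) w) (ωx k w) - gradX Φ (x k w) (y (k + 1) w)‖ ^ 2 |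
      MeasurableSpace.comap (fun w => (x k w, y (k + 1) w)) inferInstance]
    ≤ᵐ[P] fun _ => δx ^ 2
  variance_y : ∀ k,
    P[fun w => ‖Gy (x k w) (y k w) (ωy k w) - gradY Φ (x k w) (y k w)‖ ^ 2 |
      MeasurableSpace.comap (fun w => (x k w, y k w)) inferInstance]
    ≤ᵐ[P] fun _ => δy ^ 2

/-! ### The explicit SGDA parameters -/

/-- `L(β₁, β₂)`. -/
def condL (β₁ β₂ μx μy Lxx Lyx Lyy : ℝ) : ℝ :=
  max (Lxx / μx + 1 / β₁ * (Lyx ^ 2 / (μx * μy)))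
    (1 / (β₂ * (1 - β₁ - β₂)) * (Lyy ^ 2 / μy ^ 2))

/-- The rate `(1 + 1 / L(β₁, β₂))⁻¹` required by the Lipschitz constants. -/
def rhoBar (β₁ β₂ μx μy Lxx Lyx Lyy : ℝ) : ℝ :=
  (1 + 1 / condL β₁ β₂ μx μy Lxx Lyx Lyy)⁻¹

/-- The rate required by the noise in the `x`-gradients. -/
def rhoNoiseX (μx δx ε : ℝ) : ℝ :=
  if δx ^ 2 = 0 then 0 else max 0 (1 - μx / (6 * δx ^ 2) * ε)

/-- The rate required by the noise in the `y`-gradients; it is `0` as soon as the denominator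
of the displayed fraction is not positive, in particular for `δy = 0`. -/
def rhoNoiseY (β₁ β₂ μy δy ε : ℝ) : ℝ :=
  if 6 * δy ^ 2 ≤ ε * μy * (β₁ + β₂) then 0
  else max 0 ((6 * δy ^ 2 - ε * μy) / (6 * δy ^ 2 - ε * μy * (β₁ + β₂)))

/-- The SGDA rate parameter `ρ`. -/
def rhoSGDA (β₁ β₂ μx μy Lxx Lyx Lyy δx δy ε : ℝ) : ℝ :=
  max (rhoBar β₁ β₂ μx μy Lxx Lyx Lyy) (max (rhoNoiseX μx δx ε) (rhoNoiseY β₁ β₂ μy δy ε))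

end SaddlePoint

end

/-! The argument has a pathwise part and a probabilistic part.

Pathwise, one proximal step is compared with an arbitrary point of the domain
(`IsSmoothSaddle.step_le`). Since there is no momentum, the dual step uses the gradient at the old
iterate. The resulting error is paid for by the fraction `β₁ + β₂` of the strong convexity of `g`
and by the squared step lengths, which the step size conditions control. The remaining strong
convexity contracts both squared distances by the same rate `ρ`, so the weights `ρ^{-k}` telescope.
With `t = 1 / (ρ^{-N} - 1)` and `W = μx Ωf + μy Ωg`, the averaged iterates have gap at `(u, v)` at
most `t W / 2`, minus `(1 + t)` times a quadratic in `(u, v)` with moduli `μx`, `μy`, plus averaged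
noise that is affine in `(u, v)` (`IsProxPath.exists_gap_le`).

The supremum is attained at a random point, so the noise there need not have mean zero. It is
therefore split into the noise at a deterministic saddle point `(a, b)`, which exists by Sion's
theorem, and a linear term in the averaged noise vectors. Young's inequality absorbs the linear term
into the negative quadratic. The leftover distances from `(a, b)` to the centres of the quadratic
are bounded by the same gap estimate at `(a, b)`, because the gap there is nonnegative
(`IsProxPath.gap_le`).

In expectation two noise quantities remain. The noise at `(a, b)` correlates with the new iterate
only through the reaction of the proximal map, which is Lipschitz with constant `1 / (1 + s μ)`
(`integral_inner_prox_noise_le`). The averaged noise vectors are sums of orthogonal terms, so their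
variance is the variance of one term times the sum of the squared weights, which is at most `(1 + t)
(1 - ρ)`. The orthogonality needs unbiasedness given the whole past, and the freezing lemma
`condExp_comp_of_indep` derives it from unbiasedness given the current iterate.

The two noise rates in `ρ` make each noise contribution at most `ε / 6`. The iteration bound makes
`t W ≤ ε / 30`, and the constants then add up to less than `ε`. -/

namespace SaddlePoint

/-! ### Proximal operators of strongly convex functions on compact domains -/

section Prox

variable {E : Type*} [NormedAddCommGroup E] [InnerProductSpace ℝ E] {f : E → EReal} {m τ : ℝ}

lemma IsProperClosedConvex.coe_toReal (hf : IsProperClosedConvex f m) {x : E}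
    (hx : x ∈ effDom f) : ((f x).toReal : EReal) = f x :=
  EReal.coe_toReal hx (hf.ne_bot x)

lemma IsProperClosedConvex.lowerSemicontinuousOn_toReal (hf : IsProperClosedConvex f m) :
    LowerSemicontinuousOn (fun x => (f x).toReal) (effDom f) := by
  intro x hx a ha
  have h1 : (a : EReal) < f x := by
    rw [← hf.coe_toReal hx]
    exact_mod_cast ha
  filter_upwards [(hf.closed x _ h1).filter_mono nhdsWithin_le_nhds, self_mem_nhdsWithin]
    with z hz hzd
  rw [← hf.coe_toReal hzd] at hz
  exact_mod_cast hz

lemma IsProperClosedConvex.convexOn_toReal (hf : IsProperClosedConvex f m) (hm : 0 ≤ m) :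
    ConvexOn ℝ (effDom f) (fun x => (f x).toReal) :=
  UniformConvexOn.convexOn hf.convex fun r => by positivity

/-- This is the limit `α → 0`. If `X < 0`, the choice `α = -X / (2 (Y - X))` already gives `X + α Y
≤ X / 2 < 0`. -/
lemma nonneg_of_forall_add_mul_nonneg {X Y : ℝ}
    (h : ∀ α : ℝ, 0 < α → α < 1 → 0 ≤ X + α * Y) : 0 ≤ X := by
  by_contra hX
  push Not at hX
  have hY : 0 < Y := by
    have := h (1 / 2) (by norm_num) (by norm_num)
    linarith
  have h1 : 0 < -X / (2 * (Y - X)) := by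
    apply div_pos <;> linarith
  have h2 : -X / (2 * (Y - X)) < 1 := by
    rw [div_lt_one (by linarith)]
    linarith
  have h3 := h _ h1 h2
  have h4 : -X / (2 * (Y - X)) * Y ≤ -X / 2 := by
    rw [div_mul_eq_mul_div, div_le_div_iff₀ (by linarith) (by norm_num)]
    nlinarith
  linarith

/-- First-order optimality of a minimizer of a strongly convex function plus a quadratic. -/
lemma prox_optimality_of_isMin {s : Set E} {F : E → ℝ} (hF : StrongConvexOn s m F) (hτ : 0 < τ)
    {x p v : E} (hp : p ∈ s) (hv : v ∈ s)
    (hmin : ∀ v ∈ s, τ * F p + ‖x - p‖ ^ 2 / 2 ≤ τ * F v + ‖x - v‖ ^ 2 / 2) :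
    τ * F p + inner ℝ (x - p) (v - p) + τ * m / 2 * ‖v - p‖ ^ 2 ≤ τ * F v := by
  suffices h : 0 ≤ τ * F v - τ * F p - inner ℝ (x - p) (v - p) - τ * m / 2 * ‖v - p‖ ^ 2 by
    linarith
  -- The minimizer `p` is compared with `(1 - α) p + α v`. After division by `α`, the second-order
  -- remainder is `α` times this `Y`.
  refine nonneg_of_forall_add_mul_nonneg (Y := (τ * m + 1) / 2 * ‖v - p‖ ^ 2) fun α h0 h1 => ?_
  have hc := hF.2 hp hv (show 0 ≤ 1 - α by linarith) h0.le (by ring)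
  have hmem := hF.1 hp hv (show 0 ≤ 1 - α by linarith) h0.le (by ring)
  have h2 := hmin _ hmem
  have h3 : x - ((1 - α) • p + α • v) = (x - p) - α • (v - p) := by module
  rw [h3, norm_sub_sq_real (x - p) (α • (v - p)), norm_smul, inner_smul_right,
    mul_pow, Real.norm_eq_abs, sq_abs] at h2
  rw [norm_sub_rev p v] at hc
  simp only [smul_eq_mul] at hc
  have h4 := mul_le_mul_of_nonneg_left hc hτ.le
  have h5 : 0 ≤ α * (τ * F v - τ * F p - inner ℝ (x - p) (v - p) - τ * m / 2 * ‖v - p‖ ^ 2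
      + α * ((τ * m + 1) / 2 * ‖v - p‖ ^ 2)) := by
    nlinarith
  exact nonneg_of_mul_nonneg_right h5 h0

/-- By Weierstrass on the compact domain a minimizer exists, so the choice in `prox` does pick one.
The objective is `⊤` off the domain, which reduces the extended-real problem to a real one. -/
lemma prox_isMin (hf : IsProperClosedConvex f m) (hc : IsCompact (effDom f)) (hτ : 0 < τ) (x : E) :
    prox (fun v => (τ : EReal) * f v) x ∈ effDom f ∧ ∀ v ∈ effDom f,
      τ * (f (prox (fun v => (τ : EReal) * f v) x)).toReal
        + ‖x - prox (fun v => (τ : EReal) * f v) x‖ ^ 2 / 2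
      ≤ τ * (f v).toReal + ‖x - v‖ ^ 2 / 2 := by
  have hcoe : ∀ v ∈ effDom f, (τ : EReal) * f v + ((‖x - v‖ ^ 2 / 2 : ℝ) : EReal)
      = ((τ * (f v).toReal + ‖x - v‖ ^ 2 / 2 : ℝ) : EReal) := by
    intro v hv
    rw [EReal.coe_add, EReal.coe_mul, hf.coe_toReal hv]
  have htop : ∀ v, v ∉ effDom f →
      (τ : EReal) * f v + ((‖x - v‖ ^ 2 / 2 : ℝ) : EReal) = ⊤ := by
    intro v hv
    have : f v = ⊤ := by simpa [effDom] using hv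
    rw [this, EReal.coe_mul_top_of_pos hτ, EReal.top_add_coe]
  have hlsc : LowerSemicontinuousOn (fun v => τ * (f v).toReal + ‖x - v‖ ^ 2 / 2) (effDom f) := by
    apply LowerSemicontinuousOn.add
    · exact (continuous_const_mul τ).comp_lowerSemicontinuousOn hf.lowerSemicontinuousOn_toReal
        (monotone_mul_left_of_nonneg hτ.le)
    · exact (show Continuous fun v => ‖x - v‖ ^ 2 / 2 by
        fun_prop).lowerSemicontinuous.lowerSemicontinuousOn _
  obtain ⟨p, hp, hpmin⟩ := hlsc.exists_isMinOn hf.proper hc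
  have hex : ∃ p : E, ∀ v : E, (τ : EReal) * f p + ((‖x - p‖ ^ 2 / 2 : ℝ) : EReal)
      ≤ (τ : EReal) * f v + ((‖x - v‖ ^ 2 / 2 : ℝ) : EReal) := by
    refine ⟨p, fun v => ?_⟩
    by_cases hv : v ∈ effDom f
    · rw [hcoe p hp, hcoe v hv]
      exact_mod_cast hpmin hv
    · rw [htop v hv]
      exact le_top
  have hspec := Classical.epsilon_spec hex
  change ∀ v : E, (τ : EReal) * f (prox (fun v => (τ : EReal) * f v) x)
      + ((‖x - prox (fun v => (τ : EReal) * f v) x‖ ^ 2 / 2 : ℝ) : EReal)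
      ≤ (τ : EReal) * f v + ((‖x - v‖ ^ 2 / 2 : ℝ) : EReal) at hspec
  generalize prox (fun v => (τ : EReal) * f v) x = r at hspec
  have hr : r ∈ effDom f := by
    by_contra hr
    have h1 := hspec p
    rw [htop r hr, hcoe p hp, top_le_iff] at h1
    exact EReal.coe_ne_top _ h1
  refine ⟨hr, fun v hv => ?_⟩
  have h1 := hspec v
  rw [hcoe r hr, hcoe v hv] at h1
  exact_mod_cast h1

lemma prox_mem (hf : IsProperClosedConvex f m) (hc : IsCompact (effDom f)) (hτ : 0 < τ) (x : E) :
    prox (fun v => (τ : EReal) * f v) x ∈ effDom f :=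
  (prox_isMin hf hc hτ x).1

lemma prox_optimality (hf : IsProperClosedConvex f m) (hc : IsCompact (effDom f)) (hτ : 0 < τ)
    (x : E) {v : E} (hv : v ∈ effDom f) :
    τ * (f (prox (fun v => (τ : EReal) * f v) x)).toReal
      + inner ℝ (x - prox (fun v => (τ : EReal) * f v) x)
          (v - prox (fun v => (τ : EReal) * f v) x)
      + τ * m / 2 * ‖v - prox (fun v => (τ : EReal) * f v) x‖ ^ 2 ≤ τ * (f v).toReal :=
  prox_optimality_of_isMin hf.convex hτ (prox_mem hf hc hτ x) hv (prox_isMin hf hc hτ x).2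

/-- Each proximal point is tested in the optimality inequality of the other, and the two are added.
Keeping the factor `1 + τ m`, rather than mere nonexpansiveness, is what makes the noise bound `s /
(1 + s μ)` sharp enough. -/
lemma norm_prox_sub_prox_le (hf : IsProperClosedConvex f m) (hc : IsCompact (effDom f))
    (hm : 0 ≤ m) (hτ : 0 < τ) (x x' : E) :
    (1 + τ * m) * ‖prox (fun v => (τ : EReal) * f v) x - prox (fun v => (τ : EReal) * f v) x'‖
      ≤ ‖x - x'‖ := by
  have h1 := prox_optimality hf hc hτ x (prox_mem hf hc hτ x')
  have h2 := prox_optimality hf hc hτ x' (prox_mem hf hc hτ x)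
  generalize prox (fun v => (τ : EReal) * f v) x = p at *
  generalize prox (fun v => (τ : EReal) * f v) x' = p' at *
  rw [norm_sub_rev p' p] at h1
  have h3 : inner ℝ (x - p) (p' - p) + inner ℝ (x' - p') (p - p')
      = ‖p - p'‖ ^ 2 - inner ℝ (x - x') (p - p') := by
    rw [← real_inner_self_eq_norm_sq]
    simp only [inner_sub_left, inner_sub_right]
    rw [real_inner_comm p p']
    ring
  have h4 := real_inner_le_norm (x - x') (p - p')
  rcases (norm_nonneg (p - p')).eq_or_lt with h0 | h0
  · rw [← h0]
    simp
  · have : 0 ≤ τ * m := by positivity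
    nlinarith

lemma continuous_prox (hf : IsProperClosedConvex f m) (hc : IsCompact (effDom f))
    (hm : 0 ≤ m) (hτ : 0 < τ) : Continuous (prox (fun v => (τ : EReal) * f v)) := by
  refine (LipschitzWith.of_dist_le_mul (K := 1) fun x x' => ?_).continuous
  rw [dist_eq_norm, dist_eq_norm, NNReal.coe_one, one_mul]
  refine le_trans ?_ (norm_prox_sub_prox_le hf hc hm hτ x x')
  have : 0 ≤ τ * m := by positivity
  exact le_mul_of_one_le_left (norm_nonneg _) (by linarith)

end Prox

/-! ### First-order inequalities for smooth convex functions -/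

section Gradient

variable {E : Type*} [NormedAddCommGroup E] [InnerProductSpace ℝ E] [CompleteSpace E] {h : E → ℝ}

lemma hasDerivAt_lineMap_gradient (hd : Differentiable ℝ h) (x d : E) (t : ℝ) :
    HasDerivAt (fun s : ℝ => h (x + s • d)) (inner ℝ (gradient h (x + t • d)) d) t := by
  have h1 : HasDerivAt (fun s : ℝ => x + s • d) d t := by
    simpa using ((hasDerivAt_id t).smul_const d).const_add x
  have h2 := (hd (x + t • d)).hasFDerivAt.comp_hasDerivAt t h1
  rw [inner_gradient_left]
  exact h2

lemma add_inner_gradient_le (hh : ConvexOn ℝ Set.univ h) (hd : Differentiable ℝ h) (x z : E) :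
    h x + inner ℝ (gradient h x) (z - x) ≤ h z := by
  have hc : ConvexOn ℝ Set.univ (fun s : ℝ => h (x + s • (z - x))) := by
    refine ⟨convex_univ, fun a _ b _ r s hr hs hrs => ?_⟩
    have := hh.2 (Set.mem_univ (x + a • (z - x))) (Set.mem_univ (x + b • (z - x))) hr hs hrs
    refine le_trans (le_of_eq ?_) this
    obtain rfl : s = 1 - r := by linarith
    change h (x + (r * a + (1 - r) * b) • (z - x)) = _
    congr 1
    module
  have h1 := hc.le_slope_of_hasDerivAt (Set.mem_univ 0) (Set.mem_univ 1) one_pos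
    (hasDerivAt_lineMap_gradient hd x (z - x) 0)
  rw [slope_def_field, zero_smul, add_zero, one_smul, add_sub_cancel, sub_zero, div_one] at h1
  linarith

/-- The descent lemma, localized to a convex set because the gradient is Lipschitz only on the
domain. Along the segment, the derivative of `h` is dominated by that of the quadratic majorant. -/
lemma le_add_inner_gradient {s : Set E} (hs : Convex ℝ s) (hd : Differentiable ℝ h) {L : ℝ}
    (hL : ∀ x ∈ s, ∀ z ∈ s, ‖gradient h x - gradient h z‖ ≤ L * ‖x - z‖) {x z : E}
    (hx : x ∈ s) (hz : z ∈ s) :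
    h z ≤ h x + inner ℝ (gradient h x) (z - x) + L / 2 * ‖z - x‖ ^ 2 := by
  have key := image_le_of_deriv_right_le_deriv_boundary (a := 0) (b := 1)
    (f := fun s : ℝ => h (x + s • (z - x)))
    (B := fun s : ℝ => h x + s * inner ℝ (gradient h x) (z - x) + s ^ 2 * (L / 2 * ‖z - x‖ ^ 2))
    (B' := fun s : ℝ => inner ℝ (gradient h x) (z - x) + 2 * s * (L / 2 * ‖z - x‖ ^ 2))
    (fun t _ => (hasDerivAt_lineMap_gradient hd x (z - x) t).continuousAt.continuousWithinAt)
    (fun t _ => (hasDerivAt_lineMap_gradient hd x (z - x) t).hasDerivWithinAt)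
    (by simp) (by fun_prop) (fun t _ => ?_) (fun t ht => ?_) (Set.right_mem_Icc.2 zero_le_one)
  · simpa using key
  · have h1 := ((hasDerivAt_id t).mul_const (inner ℝ (gradient h x) (z - x))).const_add (h x)
    have h2 := ((hasDerivAt_id t).pow 2).mul_const (L / 2 * ‖z - x‖ ^ 2)
    have h3 := (h1.add h2).hasDerivWithinAt (s := Set.Ici t)
    exact h3.congr_deriv (by simp)
  · have hmem : x + t • (z - x) ∈ s := hs.add_smul_sub_mem hx hz ⟨ht.1, ht.2.le⟩
    have h1 := hL _ hmem _ hx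
    rw [add_sub_cancel_left, norm_smul, Real.norm_eq_abs, abs_of_nonneg ht.1] at h1
    have h2 := real_inner_le_norm (gradient h (x + t • (z - x)) - gradient h x) (z - x)
    rw [inner_sub_left] at h2
    have h3 := mul_le_mul_of_nonneg_right h1 (norm_nonneg (z - x))
    nlinarith

end Gradient

end SaddlePoint
namespace SaddlePoint

/-! ### One step of the algorithm -/

/-- The real-valued Lagrangian; it is the Lagrangian on the effective domains. -/
def realLagrangian {E F : Type*} (f : E → EReal) (g : F → EReal) (Φ : E → F → ℝ)
    (x : E) (y : F) : ℝ :=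
  (f x).toReal + Φ x y - (g y).toReal

/-- Step sizes and rate of the algorithm, with the smallness conditions on the step sizes. -/
structure IsStepRule (β₁ β₂ μx μy Lxx Lyx Lyy τ σ ρ : ℝ) : Prop where
  β₁_pos : 0 < β₁
  β₂_pos : 0 < β₂
  β_lt_one : β₁ + β₂ < 1
  μx_pos : 0 < μx
  μy_pos : 0 < μy
  ρ_pos : 0 < ρ
  ρ_lt_one : ρ < 1
  τ_eq : τ = (1 - ρ) / (μx * ρ)
  σ_eq : σ = 1 / (1 - β₁ - β₂) * ((1 - ρ) / (μy * ρ))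
  step_x : Lxx + Lyx ^ 2 / (β₁ * μy) ≤ 1 / τ
  step_y : Lyy ^ 2 / (β₂ * μy) ≤ 1 / σ

namespace IsStepRule

variable {β₁ β₂ μx μy Lxx Lyx Lyy τ σ ρ : ℝ}

lemma τ_pos (h : IsStepRule β₁ β₂ μx μy Lxx Lyx Lyy τ σ ρ) : 0 < τ := by
  rw [h.τ_eq]
  have := h.ρ_lt_one
  exact div_pos (by linarith) (mul_pos h.μx_pos h.ρ_pos)

lemma σ_pos (h : IsStepRule β₁ β₂ μx μy Lxx Lyx Lyy τ σ ρ) : 0 < σ := by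
  rw [h.σ_eq]
  have h1 := h.ρ_lt_one
  have h2 := h.β_lt_one
  exact mul_pos (div_pos one_pos (by linarith)) (div_pos (by linarith) (mul_pos h.μy_pos h.ρ_pos))

lemma one_add_τ_mul (h : IsStepRule β₁ β₂ μx μy Lxx Lyx Lyy τ σ ρ) : 1 + τ * μx = ρ⁻¹ := by
  have := h.μx_pos.ne'
  have := h.ρ_pos.ne'
  rw [h.τ_eq]
  field_simp
  ring

lemma one_add_σ_mul (h : IsStepRule β₁ β₂ μx μy Lxx Lyx Lyy τ σ ρ) :
    1 + σ * ((1 - β₁ - β₂) * μy) = ρ⁻¹ := by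
  have := h.μy_pos.ne'
  have := h.ρ_pos.ne'
  have : 1 - β₁ - β₂ ≠ 0 := by
    have := h.β_lt_one
    exact ne_of_gt (by linarith)
  rw [h.σ_eq]
  field_simp
  ring

end IsStepRule

/-- Cauchy–Schwarz in Sedrakyan's form. It divides the reserve `β₁ + β₂` between the `x`-movement
and the `y`-movement. -/
lemma add_sq_div_add_le (a b : ℝ) {c d : ℝ} (hc : 0 < c) (hd : 0 < d) :
    (a + b) ^ 2 / (c + d) ≤ a ^ 2 / c + b ^ 2 / d := by
  rw [div_add_div _ _ hc.ne' hd.ne', div_le_div_iff₀ (by positivity) (by positivity)]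
  nlinarith [mul_nonneg (mul_nonneg hc.le hd.le) (sq_nonneg (d * a - c * b)),
    sq_nonneg (d * a - c * b)]

lemma two_mul_inner_sub_sub {H : Type*} [NormedAddCommGroup H] [InnerProductSpace ℝ H]
    (a b c : H) :
    2 * inner ℝ (a - b) (c - b) = ‖b - a‖ ^ 2 + ‖c - b‖ ^ 2 - ‖c - a‖ ^ 2 := by
  have : c - a = (c - b) - (a - b) := by abel
  rw [this, norm_sub_sq_real (c - b) (a - b), norm_sub_rev b a, real_inner_comm (c - b)]
  ring

section Step

variable {E F : Type*} [NormedAddCommGroup E] [InnerProductSpace ℝ E] [CompleteSpace E]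
  [NormedAddCommGroup F] [InnerProductSpace ℝ F] [CompleteSpace F]
  {f : E → EReal} {g : F → EReal} {Φ : E → F → ℝ}
  {β₁ β₂ μx μy Lxx Lxy Lyx Lyy τ σ ρ : ℝ}

lemma IsSmoothSaddle.le_add_inner_gradY (hS : IsSmoothSaddle f g Φ μx μy Lxx Lxy Lyx Lyy)
    {x : E} (hx : x ∈ effDom f) (y z : F) :
    Φ x z ≤ Φ x y + inner ℝ (gradY Φ x y) (z - y) := by
  have h := add_inner_gradient_le (hS.concave_y x hx).neg (hS.diff_y x hx).neg y z
  rw [inner_gradient_left, fderiv_neg] at h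
  simp only [Pi.neg_apply, _root_.neg_apply] at h
  rw [gradY, inner_gradient_left]
  linarith

/-- The price of evaluating the dual gradient at the old iterate. The two coefficients are exactly
those that `step_x` and `step_y` bound by inverse step sizes. -/
lemma IsSmoothSaddle.norm_gradY_sub_sq_le (hS : IsSmoothSaddle f g Φ μx μy Lxx Lxy Lyx Lyy)
    (hr : IsStepRule β₁ β₂ μx μy Lxx Lyx Lyy τ σ ρ)
    {x x' : E} (hx : x ∈ effDom f) (hx' : x' ∈ effDom f)
    {y y' : F} (hy : y ∈ effDom g) (hy' : y' ∈ effDom g) :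
    ‖gradY Φ x y - gradY Φ x' y'‖ ^ 2 / ((β₁ + β₂) * μy)
      ≤ Lyx ^ 2 / (β₁ * μy) * ‖x - x'‖ ^ 2 + Lyy ^ 2 / (β₂ * μy) * ‖y - y'‖ ^ 2 := by
  have h1 := hS.lip_y x hx x' hx' y hy y' hy'
  have hβ₁ := hr.β₁_pos
  have hβ₂ := hr.β₂_pos
  have hμ := hr.μy_pos
  have h2 : ‖gradY Φ x y - gradY Φ x' y'‖ ^ 2 ≤ (Lyx * ‖x - x'‖ + Lyy * ‖y - y'‖) ^ 2 :=
    pow_le_pow_left₀ (norm_nonneg _) h1 2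
  refine (div_le_div_of_nonneg_right h2 (by positivity)).trans ?_
  have h3 := add_sq_div_add_le (Lyx * ‖x - x'‖) (Lyy * ‖y - y'‖) hβ₁ hβ₂
  calc (Lyx * ‖x - x'‖ + Lyy * ‖y - y'‖) ^ 2 / ((β₁ + β₂) * μy)
      = (Lyx * ‖x - x'‖ + Lyy * ‖y - y'‖) ^ 2 / (β₁ + β₂) / μy := by rw [div_div]
    _ ≤ ((Lyx * ‖x - x'‖) ^ 2 / β₁ + (Lyy * ‖y - y'‖) ^ 2 / β₂) / μy := by gcongr
    _ = _ := by field_simp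

/-- The one-step estimate, for a proximal step along arbitrary directions `gx`, `gy`. -/
lemma IsSmoothSaddle.step_le (hS : IsSmoothSaddle f g Φ μx μy Lxx Lxy Lyx Lyy)
    (hr : IsStepRule β₁ β₂ μx μy Lxx Lyx Lyy τ σ ρ)
    {x₀ x₁ x : E} (hx₀ : x₀ ∈ effDom f) (hx₁ : x₁ ∈ effDom f)
    {y₀ y₁ y : F} (hy₀ : y₀ ∈ effDom g) (hy₁ : y₁ ∈ effDom g)
    {gx : E} {gy : F}
    (hpx : τ * (f x₁).toReal + inner ℝ (x₀ - τ • gx - x₁) (x - x₁) + τ * μx / 2 * ‖x - x₁‖ ^ 2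
      ≤ τ * (f x).toReal)
    (hpy : σ * (g y₁).toReal + inner ℝ (y₀ + σ • gy - y₁) (y - y₁) + σ * μy / 2 * ‖y - y₁‖ ^ 2
      ≤ σ * (g y).toReal) :
    realLagrangian f g Φ x₁ y - realLagrangian f g Φ x y₁
      ≤ 1 / (2 * τ) * (‖x - x₀‖ ^ 2 - ρ⁻¹ * ‖x - x₁‖ ^ 2)
        + 1 / (2 * σ) * (‖y - y₀‖ ^ 2 - ρ⁻¹ * ‖y - y₁‖ ^ 2)
        - (β₁ + β₂) * μy / 2
          * ‖y - (y₁ + ((β₁ + β₂) * μy)⁻¹ • (gradY Φ x₁ y₁ - gradY Φ x₀ y₀))‖ ^ 2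
        + (inner ℝ (gx - gradX Φ x₀ y₁) (x - x₁) - inner ℝ (gy - gradY Φ x₀ y₀) (y - y₁)) := by
  have hτ := hr.τ_pos
  have hσ := hr.σ_pos
  have hβ₁ := hr.β₁_pos
  have hβ₂ := hr.β₂_pos
  have hμ := hr.μy_pos
  have hA : Φ x₁ y₁ ≤ Φ x₀ y₁ + inner ℝ (gradX Φ x₀ y₁) (x₁ - x₀) + Lxx / 2 * ‖x₁ - x₀‖ ^ 2 := by
    refine le_add_inner_gradient hS.f_convex.convex.1 (hS.diff_x y₁ hy₁) (fun u hu v hv => ?_)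
      hx₀ hx₁
    simpa [gradX] using hS.lip_x u hu v hv y₁ hy₁ y₁ hy₁
  have hB : Φ x₀ y₁ + inner ℝ (gradX Φ x₀ y₁) (x - x₀) ≤ Φ x y₁ :=
    add_inner_gradient_le (hS.convex_x y₁ hy₁) (hS.diff_x y₁ hy₁) x₀ x
  have hC := hS.le_add_inner_gradY hx₁ y₁ y
  have hD := hS.norm_gradY_sub_sq_le hr hx₁ hx₀ hy₁ hy₀
  have hsx := mul_le_mul_of_nonneg_right hr.step_x (sq_nonneg ‖x₁ - x₀‖)
  have hsy := mul_le_mul_of_nonneg_right hr.step_y (sq_nonneg ‖y₁ - y₀‖)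
  have h3x := two_mul_inner_sub_sub x₀ x₁ x
  have h3y := two_mul_inner_sub_sub y₀ y₁ y
  have hpx' : (f x₁).toReal - (f x).toReal ≤ 1 / (2 * τ) * (‖x - x₀‖ ^ 2 - ‖x - x₁‖ ^ 2)
      - 1 / τ * ‖x₁ - x₀‖ ^ 2 / 2 - μx / 2 * ‖x - x₁‖ ^ 2 + inner ℝ gx (x - x₁) := by
    have e : x₀ - τ • gx - x₁ = (x₀ - x₁) - τ • gx := by abel
    rw [e, inner_sub_left, real_inner_smul_left] at hpx
    have e2 : 1 / (2 * τ) * (‖x - x₀‖ ^ 2 - ‖x - x₁‖ ^ 2) - 1 / τ * ‖x₁ - x₀‖ ^ 2 / 2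
        - μx / 2 * ‖x - x₁‖ ^ 2 + inner ℝ gx (x - x₁)
        = (-inner ℝ (x₀ - x₁) (x - x₁) - τ * μx / 2 * ‖x - x₁‖ ^ 2 + τ * inner ℝ gx (x - x₁))
          / τ := by
      field_simp
      linarith
    rw [e2, le_div_iff₀ hτ]
    linarith
  have hpy' : (g y₁).toReal - (g y).toReal ≤ 1 / (2 * σ) * (‖y - y₀‖ ^ 2 - ‖y - y₁‖ ^ 2)
      - 1 / σ * ‖y₁ - y₀‖ ^ 2 / 2 - μy / 2 * ‖y - y₁‖ ^ 2 - inner ℝ gy (y - y₁) := by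
    have e : y₀ + σ • gy - y₁ = (y₀ - y₁) + σ • gy := by abel
    rw [e, inner_add_left, real_inner_smul_left] at hpy
    have e2 : 1 / (2 * σ) * (‖y - y₀‖ ^ 2 - ‖y - y₁‖ ^ 2) - 1 / σ * ‖y₁ - y₀‖ ^ 2 / 2
        - μy / 2 * ‖y - y₁‖ ^ 2 - inner ℝ gy (y - y₁)
        = (-inner ℝ (y₀ - y₁) (y - y₁) - σ * μy / 2 * ‖y - y₁‖ ^ 2 - σ * inner ℝ gy (y - y₁))
          / σ := by
      field_simp
      linarith
    rw [e2, le_div_iff₀ hσ]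
    linarith
  -- Completing the square against the reserved part of the strong convexity of `g`. The square is
  -- kept, since its centre does not involve `y` and it later restores the full modulus `μy`.
  have hsq : (β₁ + β₂) * μy / 2
      * ‖y - (y₁ + ((β₁ + β₂) * μy)⁻¹ • (gradY Φ x₁ y₁ - gradY Φ x₀ y₀))‖ ^ 2
      = (β₁ + β₂) * μy / 2 * ‖y - y₁‖ ^ 2
        - (inner ℝ (gradY Φ x₁ y₁) (y - y₁) - inner ℝ (gradY Φ x₀ y₀) (y - y₁))
        + ‖gradY Φ x₁ y₁ - gradY Φ x₀ y₀‖ ^ 2 / ((β₁ + β₂) * μy) / 2 := by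
    rw [← sub_sub, norm_sub_sq_real (y - y₁), real_inner_smul_right, norm_smul, mul_pow,
      Real.norm_eq_abs, sq_abs, real_inner_comm, inner_sub_left]
    field_simp
  have hρx : 1 / (2 * τ) * (ρ⁻¹ * ‖x - x₁‖ ^ 2)
      = 1 / (2 * τ) * ‖x - x₁‖ ^ 2 + μx / 2 * ‖x - x₁‖ ^ 2 := by
    rw [← hr.one_add_τ_mul]
    field_simp
  have hρy : 1 / (2 * σ) * (ρ⁻¹ * ‖y - y₁‖ ^ 2)
      = 1 / (2 * σ) * ‖y - y₁‖ ^ 2 + (1 - β₁ - β₂) * μy / 2 * ‖y - y₁‖ ^ 2 := by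
    rw [← hr.one_add_σ_mul]
    field_simp
  have hix : inner ℝ (gradX Φ x₀ y₁) (x₁ - x₀) - inner ℝ (gradX Φ x₀ y₁) (x - x₀)
      = - inner ℝ (gradX Φ x₀ y₁) (x - x₁) := by
    simp only [inner_sub_right]
    ring
  rw [hsq, inner_sub_left, inner_sub_left, mul_sub, mul_sub, hρx, hρy]
  simp only [realLagrangian]
  linarith

end Step
end SaddlePoint
namespace SaddlePoint

/-! ### Normalized geometric weights -/

/-- The normalized weights `ρ^{-k} / ∑_{j<N} ρ^{-j}`. -/
noncomputable def avgWeight (ρ : ℝ) (N k : ℕ) : ℝ :=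
  (∑ j ∈ Finset.range N, (ρ ^ j)⁻¹)⁻¹ * (ρ ^ k)⁻¹

/-- The ratio `1 / (ρ^{-N} - 1)`, by which the initial error is damped. -/
noncomputable def tailRatio (ρ : ℝ) (N : ℕ) : ℝ := ((ρ ^ N)⁻¹ - 1)⁻¹

section Weights

variable {ρ : ℝ} {N : ℕ}

lemma weightedAvg_eq {E Ω : Type*} [NormedAddCommGroup E] [InnerProductSpace ℝ E]
    (z : ℕ → Ω → E) (w : Ω) :
    weightedAvg ρ z N w = ∑ k ∈ Finset.range N, avgWeight ρ N k • z (k + 1) w := by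
  simp only [weightedAvg, avgWeight, Finset.smul_sum, smul_smul]

lemma sum_inv_pow_pos (hρ : 0 < ρ) (hN : 1 ≤ N) : 0 < ∑ j ∈ Finset.range N, (ρ ^ j)⁻¹ :=
  Finset.sum_pos (fun _ _ => by positivity) (by simpa using Nat.one_le_iff_ne_zero.1 hN)

lemma avgWeight_nonneg (hρ : 0 < ρ) (k : ℕ) : 0 ≤ avgWeight ρ N k :=
  mul_nonneg (inv_nonneg.2 (Finset.sum_nonneg fun _ _ => by positivity)) (by positivity)

lemma sum_avgWeight (hρ : 0 < ρ) (hN : 1 ≤ N) : ∑ k ∈ Finset.range N, avgWeight ρ N k = 1 := by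
  simp only [avgWeight, ← Finset.mul_sum]
  exact inv_mul_cancel₀ (sum_inv_pow_pos hρ hN).ne'

lemma one_lt_inv_pow (hρ : 0 < ρ) (hρ1 : ρ < 1) (hN : 1 ≤ N) : 1 < (ρ ^ N)⁻¹ :=
  (one_lt_inv₀ (by positivity)).2 (pow_lt_one₀ hρ.le hρ1 (by omega))

lemma tailRatio_pos (hρ : 0 < ρ) (hρ1 : ρ < 1) (hN : 1 ≤ N) : 0 < tailRatio ρ N :=
  inv_pos.2 (by linarith [one_lt_inv_pow hρ hρ1 hN])

lemma sum_inv_pow_mul : (∑ j ∈ Finset.range N, (ρ ^ j)⁻¹) * (ρ⁻¹ - 1) = (ρ ^ N)⁻¹ - 1 := by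
  simp only [← inv_pow]
  exact geom_sum_mul _ _

lemma inv_sum_inv_pow (hρ : 0 < ρ) (hρ1 : ρ < 1) :
    (∑ j ∈ Finset.range N, (ρ ^ j)⁻¹)⁻¹ = (ρ⁻¹ - 1) * tailRatio ρ N := by
  have h1 : 0 < ρ⁻¹ - 1 := by linarith [(one_lt_inv₀ hρ).2 hρ1]
  rw [tailRatio, ← sum_inv_pow_mul, mul_inv, mul_left_comm,
    mul_inv_cancel₀ h1.ne', mul_one]

lemma tailRatio_mul_inv_pow (hρ : 0 < ρ) (hρ1 : ρ < 1) (hN : 1 ≤ N) :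
    tailRatio ρ N * (ρ ^ N)⁻¹ = 1 + tailRatio ρ N := by
  have h1 : 0 < (ρ ^ N)⁻¹ - 1 := by linarith [one_lt_inv_pow hρ hρ1 hN]
  rw [tailRatio]
  generalize (ρ ^ N)⁻¹ = Q at *
  field_simp
  ring

/-- The weights turn contraction by `ρ` into a telescoping sum, and `t ρ^{-N} = 1 + t` puts the
final coefficient in this form. -/
lemma sum_avgWeight_telescope (hρ : 0 < ρ) (hρ1 : ρ < 1) (hN : 1 ≤ N) (d : ℕ → ℝ) :
    ∑ k ∈ Finset.range N, avgWeight ρ N k * (d k - ρ⁻¹ * d (k + 1))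
      = (ρ⁻¹ - 1) * (tailRatio ρ N * d 0 - (1 + tailRatio ρ N) * d N) := by
  have h1 : ∀ k ∈ Finset.range N, avgWeight ρ N k * (d k - ρ⁻¹ * d (k + 1))
      = (∑ j ∈ Finset.range N, (ρ ^ j)⁻¹)⁻¹
        * ((ρ ^ k)⁻¹ * d k - (ρ ^ (k + 1))⁻¹ * d (k + 1)) := by
    intro k _
    rw [avgWeight, pow_succ, mul_inv]
    ring
  rw [Finset.sum_congr rfl h1, ← Finset.mul_sum,
    Finset.sum_range_sub' (fun k => (ρ ^ k)⁻¹ * d k), inv_sum_inv_pow hρ hρ1,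
    ← tailRatio_mul_inv_pow hρ hρ1 hN]
  simp only [pow_zero, inv_one, one_mul]
  ring

/-- With `q = ρ⁻¹` and `Q = q ^ N`, the left side is the geometric sum `(q - 1) (Q + 1) / ((Q - 1)
(q + 1))`, and the claim reduces to `q ≤ Q`. The factor `1 + t` cancels later against the strength
of the negative quadratic. -/
lemma sum_avgWeight_sq_le (hρ : 0 < ρ) (hρ1 : ρ < 1) (hN : 1 ≤ N) :
    ∑ k ∈ Finset.range N, avgWeight ρ N k ^ 2 ≤ (1 + tailRatio ρ N) * (1 - ρ) := by
  set q := ρ⁻¹ with hq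
  have hq1 : 1 < q := (one_lt_inv₀ hρ).2 hρ1
  have hQ1 : 1 < q ^ N := by
    rw [hq, inv_pow]
    exact one_lt_inv_pow hρ hρ1 hN
  have hqQ : q ≤ q ^ N := le_self_pow₀ hq1.le (by omega)
  have ht : tailRatio ρ N = (q ^ N - 1)⁻¹ := by rw [tailRatio, hq, inv_pow]
  have hρq : ρ = q⁻¹ := by rw [hq, inv_inv]
  have h1 : ∀ k ∈ Finset.range N, avgWeight ρ N k ^ 2
      = ((q - 1) * (q ^ N - 1)⁻¹) ^ 2 * (q ^ 2) ^ k := by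
    intro k _
    rw [avgWeight, inv_sum_inv_pow hρ hρ1, ht, mul_pow, ← inv_pow, ← hq, ← pow_mul, ← pow_mul,
      mul_comm k 2]
  have hq2 : q ^ 2 ≠ 1 := by nlinarith
  rw [Finset.sum_congr rfl h1, ← Finset.mul_sum, geom_sum_eq hq2, ht, hρq, ← pow_mul,
    mul_comm 2 N, pow_mul]
  generalize q ^ N = Q at *
  have hQ : 0 < Q - 1 := by linarith
  have hqp : 0 < q - 1 := by linarith
  have hqp' : 0 < q + 1 := by linarith
  have hq0 : 0 < q := by linarith
  have e1 : ((q - 1) * (Q - 1)⁻¹) ^ 2 * ((Q ^ 2 - 1) / (q ^ 2 - 1))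
      = (q - 1) * (Q + 1) / ((Q - 1) * (q + 1)) := by
    rw [show Q ^ 2 - 1 = (Q - 1) * (Q + 1) by ring, show q ^ 2 - 1 = (q - 1) * (q + 1) by ring]
    field_simp
  have e2 : (1 + (Q - 1)⁻¹) * (1 - q⁻¹) = Q * (q - 1) / ((Q - 1) * q) := by
    field_simp
    ring
  rw [e1, e2, div_le_div_iff₀ (by positivity) (by positivity)]
  have : (Q + 1) * q ≤ Q * (q + 1) := by linarith
  have h3 := mul_le_mul_of_nonneg_left this (mul_nonneg hqp.le hQ.le)
  linarith

lemma norm_sum_smul_sq_le {H ι : Type*} [NormedAddCommGroup H] [NormedSpace ℝ H]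
    (s : Finset ι) (w : ι → ℝ) (hw : ∀ i ∈ s, 0 ≤ w i) (hw1 : ∑ i ∈ s, w i = 1) (z : ι → H) :
    ‖∑ i ∈ s, w i • z i‖ ^ 2 ≤ ∑ i ∈ s, w i * ‖z i‖ ^ 2 := by
  have hc : ConvexOn ℝ Set.univ (fun v : H => ‖v‖ ^ 2) :=
    convexOn_univ_norm.pow (fun _ _ => norm_nonneg _) 2
  exact hc.map_sum_le hw hw1 (fun _ _ => Set.mem_univ _)

/-- Convexity of the squared norm merges two quadratics into one whose centre is the weighted mean
of theirs. -/
lemma mul_norm_sub_sq_le {H : Type*} [NormedAddCommGroup H] [NormedSpace ℝ H] {a b : ℝ}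
    (ha : 0 < a) (hb : 0 < b) (y u v : H) :
    (a + b) * ‖y - (a + b)⁻¹ • (a • u + b • v)‖ ^ 2 ≤ a * ‖y - u‖ ^ 2 + b * ‖y - v‖ ^ 2 := by
  have hc : ConvexOn ℝ Set.univ (fun v : H => ‖v‖ ^ 2) :=
    convexOn_univ_norm.pow (fun _ _ => norm_nonneg _) 2
  have hab : 0 < a + b := by positivity
  have h := hc.2 (Set.mem_univ (y - u)) (Set.mem_univ (y - v)) (div_nonneg ha.le hab.le)
    (div_nonneg hb.le hab.le) (by field_simp)
  have e : (a / (a + b)) • (y - u) + (b / (a + b)) • (y - v)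
      = y - (a + b)⁻¹ • (a • u + b • v) := by
    have e1 : (a + b)⁻¹ * a + (a + b)⁻¹ * b = 1 := by field_simp
    rw [div_eq_inv_mul, div_eq_inv_mul]
    calc _ = ((a + b)⁻¹ * a + (a + b)⁻¹ * b) • y - (a + b)⁻¹ • (a • u + b • v) := by module
      _ = _ := by rw [e1, one_smul]
  simp only [e, smul_eq_mul] at h
  calc _ ≤ (a + b) * (a / (a + b) * ‖y - u‖ ^ 2 + b / (a + b) * ‖y - v‖ ^ 2) := by gcongr
    _ = _ := by field_simp

end Weights

/-! ### The pathwise estimate -/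

section Path

variable {E F : Type*} [NormedAddCommGroup E] [InnerProductSpace ℝ E] [CompleteSpace E]
  [NormedAddCommGroup F] [InnerProductSpace ℝ F] [CompleteSpace F]
  {f : E → EReal} {g : F → EReal} {Φ : E → F → ℝ}
  {β₁ β₂ μx μy Lxx Lxy Lyx Lyy τ σ ρ Ωf Ωg : ℝ}

/-- A sequence of proximal steps along directions `gx k`, `gy k`. -/
structure IsProxPath (f : E → EReal) (g : F → EReal) (μx μy τ σ : ℝ)
    (x : ℕ → E) (y : ℕ → F) (gx : ℕ → E) (gy : ℕ → F) : Prop where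
  mem_x : ∀ k, x k ∈ effDom f
  mem_y : ∀ k, y k ∈ effDom g
  prox_x : ∀ k, ∀ v ∈ effDom f,
    τ * (f (x (k + 1))).toReal + inner ℝ (x k - τ • gx k - x (k + 1)) (v - x (k + 1))
      + τ * μx / 2 * ‖v - x (k + 1)‖ ^ 2 ≤ τ * (f v).toReal
  prox_y : ∀ k, ∀ v ∈ effDom g,
    σ * (g (y (k + 1))).toReal + inner ℝ (y k + σ • gy k - y (k + 1)) (v - y (k + 1))
      + σ * μy / 2 * ‖v - y (k + 1)‖ ^ 2 ≤ σ * (g v).toReal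

variable {x : ℕ → E} {y : ℕ → F} {gx : ℕ → E} {gy : ℕ → F} {N : ℕ}

lemma realLagrangian_avg_sub_le (hS : IsSmoothSaddle f g Φ μx μy Lxx Lxy Lyx Lyy)
    (hμx : 0 ≤ μx) (hμy : 0 ≤ μy) {ι : Type*} {s : Finset ι} {w : ι → ℝ}
    (hw : ∀ i ∈ s, 0 ≤ w i) (hw1 : ∑ i ∈ s, w i = 1) {a : ι → E} {b : ι → F}
    (ha : ∀ i ∈ s, a i ∈ effDom f) (hb : ∀ i ∈ s, b i ∈ effDom g)
    {u : E} {v : F} (hu : u ∈ effDom f) (hv : v ∈ effDom g) :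
    realLagrangian f g Φ (∑ i ∈ s, w i • a i) v - realLagrangian f g Φ u (∑ i ∈ s, w i • b i)
      ≤ ∑ i ∈ s, w i * (realLagrangian f g Φ (a i) v - realLagrangian f g Φ u (b i)) := by
  have h1 := (hS.f_convex.convexOn_toReal hμx).map_sum_le hw hw1 ha
  have h2 := (hS.g_convex.convexOn_toReal hμy).map_sum_le hw hw1 hb
  have h3 := (hS.convex_x v hv).map_sum_le hw hw1 (p := a) (fun _ _ => Set.mem_univ _)
  have h4 := (hS.concave_y u hu).le_map_sum hw hw1 (p := b) (fun _ _ => Set.mem_univ _)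
  simp only [smul_eq_mul] at h1 h2 h3 h4
  have h5 : ∑ i ∈ s, w i * (realLagrangian f g Φ (a i) v - realLagrangian f g Φ u (b i))
      = ∑ i ∈ s, w i * (f (a i)).toReal + ∑ i ∈ s, w i * Φ (a i) v
        - ∑ i ∈ s, w i * Φ u (b i) + ∑ i ∈ s, w i * (g (b i)).toReal
        - (∑ i ∈ s, w i) * ((g v).toReal + (f u).toReal) := by
    rw [Finset.sum_mul, ← Finset.sum_add_distrib, ← Finset.sum_sub_distrib,
      ← Finset.sum_add_distrib, ← Finset.sum_sub_distrib]
    refine Finset.sum_congr rfl fun i _ => ?_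
    simp only [realLagrangian]
    ring
  rw [h5, hw1]
  simp only [realLagrangian]
  linarith

/-- The gap of the averaged iterates at an arbitrary point of the domain. The centre `c` of the
last quadratic term does not depend on the point. -/
lemma IsProxPath.exists_gap_le (hp : IsProxPath f g μx μy τ σ x y gx gy)
    (hS : IsSmoothSaddle f g Φ μx μy Lxx Lxy Lyx Lyy)
    (hr : IsStepRule β₁ β₂ μx μy Lxx Lyx Lyy τ σ ρ) (hc : HasCompactDomains f g Ωf Ωg)
    (hN : 1 ≤ N) :
    ∃ c : F, ∀ u ∈ effDom f, ∀ v ∈ effDom g,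
      realLagrangian f g Φ (∑ k ∈ Finset.range N, avgWeight ρ N k • x (k + 1)) v
        - realLagrangian f g Φ u (∑ k ∈ Finset.range N, avgWeight ρ N k • y (k + 1))
      ≤ tailRatio ρ N / 2 * (μx * Ωf + μy * Ωg)
        - (1 + tailRatio ρ N) * (μx / 2 * ‖u - x N‖ ^ 2 + μy / 2 * ‖v - c‖ ^ 2)
        + ∑ k ∈ Finset.range N, avgWeight ρ N k *
          (inner ℝ (gx k - gradX Φ (x k) (y (k + 1))) (u - x (k + 1))
            - inner ℝ (gy k - gradY Φ (x k) (y k)) (v - y (k + 1))) := by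
  have hρ := hr.ρ_pos
  have hρ1 := hr.ρ_lt_one
  have hβ₁ := hr.β₁_pos
  have hβ₂ := hr.β₂_pos
  have hβ := hr.β_lt_one
  have hμx := hr.μx_pos
  have hμy := hr.μy_pos
  have hτ := hr.τ_pos
  have hσ := hr.σ_pos
  have ht := tailRatio_pos hρ hρ1 hN
  set t := tailRatio ρ N with ht_def
  set b := β₁ + β₂ with hb
  have hb0 : 0 < b := by positivity
  have hbt : 0 < 1 - b + t := by linarith
  let p : ℕ → F := fun k => y (k + 1) + (b * μy)⁻¹ •
    (gradY Φ (x (k + 1)) (y (k + 1)) - gradY Φ (x k) (y k))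
  let pbar : F := ∑ k ∈ Finset.range N, avgWeight ρ N k • p k
  -- The centre averages the last iterate `y N` and the mean `pbar` of the centres left by
  -- completing the square. The weights `1 - b + t` and `b` add up to `1 + t`.
  refine ⟨(1 - b + t + b)⁻¹ • ((1 - b + t) • y N + b • pbar), fun u hu v hv => ?_⟩
  have hw : ∀ k ∈ Finset.range N, 0 ≤ avgWeight ρ N k := fun k _ => avgWeight_nonneg hρ k
  have hw1 := sum_avgWeight hρ hN
  refine (realLagrangian_avg_sub_le hS hμx.le hμy.le hw hw1 (fun k _ => hp.mem_x (k + 1))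
    (fun k _ => hp.mem_y (k + 1)) hu hv).trans ?_
  have hstep : ∀ k ∈ Finset.range N, avgWeight ρ N k *
      (realLagrangian f g Φ (x (k + 1)) v - realLagrangian f g Φ u (y (k + 1)))
      ≤ avgWeight ρ N k * (1 / (2 * τ) * (‖u - x k‖ ^ 2 - ρ⁻¹ * ‖u - x (k + 1)‖ ^ 2)
        + 1 / (2 * σ) * (‖v - y k‖ ^ 2 - ρ⁻¹ * ‖v - y (k + 1)‖ ^ 2)
        - b * μy / 2 * ‖v - p k‖ ^ 2
        + (inner ℝ (gx k - gradX Φ (x k) (y (k + 1))) (u - x (k + 1))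
            - inner ℝ (gy k - gradY Φ (x k) (y k)) (v - y (k + 1)))) := fun k hk =>
    mul_le_mul_of_nonneg_left (hS.step_le hr (hp.mem_x k) (hp.mem_x (k + 1)) (hp.mem_y k)
      (hp.mem_y (k + 1)) (hp.prox_x k u hu) (hp.prox_y k v hv)) (hw k hk)
  refine (Finset.sum_le_sum hstep).trans ?_
  have hsplit : ∑ k ∈ Finset.range N, avgWeight ρ N k *
        (1 / (2 * τ) * (‖u - x k‖ ^ 2 - ρ⁻¹ * ‖u - x (k + 1)‖ ^ 2)
        + 1 / (2 * σ) * (‖v - y k‖ ^ 2 - ρ⁻¹ * ‖v - y (k + 1)‖ ^ 2)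
        - b * μy / 2 * ‖v - p k‖ ^ 2
        + (inner ℝ (gx k - gradX Φ (x k) (y (k + 1))) (u - x (k + 1))
            - inner ℝ (gy k - gradY Φ (x k) (y k)) (v - y (k + 1))))
      = 1 / (2 * τ) * ((ρ⁻¹ - 1) * (t * ‖u - x 0‖ ^ 2 - (1 + t) * ‖u - x N‖ ^ 2))
        + 1 / (2 * σ) * ((ρ⁻¹ - 1) * (t * ‖v - y 0‖ ^ 2 - (1 + t) * ‖v - y N‖ ^ 2))
        - b * μy / 2 * ∑ k ∈ Finset.range N, avgWeight ρ N k * ‖v - p k‖ ^ 2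
        + ∑ k ∈ Finset.range N, avgWeight ρ N k *
          (inner ℝ (gx k - gradX Φ (x k) (y (k + 1))) (u - x (k + 1))
            - inner ℝ (gy k - gradY Φ (x k) (y k)) (v - y (k + 1))) := by
    rw [← sum_avgWeight_telescope hρ hρ1 hN (fun k => ‖u - x k‖ ^ 2),
      ← sum_avgWeight_telescope hρ hρ1 hN (fun k => ‖v - y k‖ ^ 2), Finset.mul_sum,
      Finset.mul_sum, Finset.mul_sum, ← Finset.sum_add_distrib, ← Finset.sum_sub_distrib,
      ← Finset.sum_add_distrib]
    refine Finset.sum_congr rfl fun k _ => ?_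
    ring
  have hpbar : ‖v - pbar‖ ^ 2 ≤ ∑ k ∈ Finset.range N, avgWeight ρ N k * ‖v - p k‖ ^ 2 := by
    have h := norm_sum_smul_sq_le (Finset.range N) _ hw hw1 (fun k => v - p k)
    simpa only [smul_sub, Finset.sum_sub_distrib, ← Finset.sum_smul, hw1, one_smul] using h
  have hcen := mul_norm_sub_sq_le hbt hb0 v (y N) pbar
  have hb1 : 1 - b + t + b = 1 + t := by ring
  -- The step sizes cancel: after telescoping only the moduli remain in front of the squared
  -- distances.
  have hqx : 1 / (2 * τ) * (ρ⁻¹ - 1) = μx / 2 := by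
    rw [← hr.one_add_τ_mul]
    field_simp
    ring
  have hqy : 1 / (2 * σ) * (ρ⁻¹ - 1) = (1 - b) * μy / 2 := by
    rw [← hr.one_add_σ_mul]
    field_simp
    ring
  have hdx := hc.diam_f u hu _ (hp.mem_x 0)
  have hdy := hc.diam_g v hv _ (hp.mem_y 0)
  have hdyN := hc.diam_g v hv _ (hp.mem_y N)
  rw [hsplit, ← mul_assoc, ← mul_assoc, hqx, hqy]
  rw [hb1] at hcen ⊢
  have k1 : μx * t * ‖u - x 0‖ ^ 2 ≤ μx * t * Ωf := by gcongr
  have k2 : (1 - b) * μy * t * ‖v - y 0‖ ^ 2 ≤ (1 - b) * μy * t * Ωg :=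
    mul_le_mul_of_nonneg_left hdy (mul_nonneg (mul_nonneg (by linarith) hμy.le) ht.le)
  -- Telescoping gives `‖v - y N‖ ^ 2` the coefficient `(1 + t) (1 - b) = (1 - b + t) - b t`. The
  -- missing `b t` is borrowed from the diameter bound, which raises the share `(1 - b) t` of `Ωg`
  -- to `t`.
  have k3 : b * μy * t * ‖v - y N‖ ^ 2 ≤ b * μy * t * Ωg := by gcongr
  have k4 := mul_le_mul_of_nonneg_left hpbar (show 0 ≤ b * μy / 2 by positivity)
  have k5 := mul_le_mul_of_nonneg_left hcen (show 0 ≤ μy / 2 by positivity)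
  generalize ‖v - (1 + t)⁻¹ • ((1 - b + t) • y N + b • pbar)‖ ^ 2 = Z at *
  generalize ‖v - pbar‖ ^ 2 = Z1 at *
  linarith

lemma inner_le_mul_sq_add_div {H : Type*} [NormedAddCommGroup H] [InnerProductSpace ℝ H]
    (a b : H) {c : ℝ} (hc : 0 < c) : inner ℝ a b ≤ c / 2 * ‖b‖ ^ 2 + ‖a‖ ^ 2 / (2 * c) := by
  have h1 := real_inner_le_norm a b
  have h2 : ‖a‖ * ‖b‖ ≤ c / 2 * ‖b‖ ^ 2 + ‖a‖ ^ 2 / (2 * c) := by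
    have : c / 2 * ‖b‖ ^ 2 + ‖a‖ ^ 2 / (2 * c) - ‖a‖ * ‖b‖ = (c * ‖b‖ - ‖a‖) ^ 2 / (2 * c) := by
      field_simp
      ring
    have h3 : 0 ≤ (c * ‖b‖ - ‖a‖) ^ 2 / (2 * c) := by positivity
    linarith
  linarith

/-- A pathwise bound on the primal-dual gap, uniform over the domain. The noise enters only through
its averages and through its correlation with the errors relative to a saddle point `(a, b)`. -/
lemma IsProxPath.gap_le (hp : IsProxPath f g μx μy τ σ x y gx gy)
    (hS : IsSmoothSaddle f g Φ μx μy Lxx Lxy Lyx Lyy)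
    (hr : IsStepRule β₁ β₂ μx μy Lxx Lyx Lyy τ σ ρ) (hc : HasCompactDomains f g Ωf Ωg)
    (hN : 1 ≤ N) {a : E} {b : F} (ha : a ∈ effDom f) (hb : b ∈ effDom g)
    (hab : 0 ≤ realLagrangian f g Φ (∑ k ∈ Finset.range N, avgWeight ρ N k • x (k + 1)) b
        - realLagrangian f g Φ a (∑ k ∈ Finset.range N, avgWeight ρ N k • y (k + 1)))
    {u : E} {v : F} (hu : u ∈ effDom f) (hv : v ∈ effDom g) :
    realLagrangian f g Φ (∑ k ∈ Finset.range N, avgWeight ρ N k • x (k + 1)) v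
        - realLagrangian f g Φ u (∑ k ∈ Finset.range N, avgWeight ρ N k • y (k + 1))
      ≤ 17 / 10 * (tailRatio ρ N / 2 * (μx * Ωf + μy * Ωg)
          + ∑ k ∈ Finset.range N, avgWeight ρ N k *
            (inner ℝ (gx k - gradX Φ (x k) (y (k + 1))) (a - x (k + 1))
              - inner ℝ (gy k - gradY Φ (x k) (y k)) (b - y (k + 1))))
        + 17 / 14 * (1 + tailRatio ρ N)⁻¹ *
          (‖∑ k ∈ Finset.range N, avgWeight ρ N k • (gx k - gradX Φ (x k) (y (k + 1)))‖ ^ 2 / μx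
            + ‖∑ k ∈ Finset.range N, avgWeight ρ N k • (gy k - gradY Φ (x k) (y k))‖ ^ 2 / μy) := by
  obtain ⟨c, hgap⟩ := hp.exists_gap_le hS hr hc hN
  have ht := tailRatio_pos hr.ρ_pos hr.ρ_lt_one hN
  have hμx := hr.μx_pos
  have hμy := hr.μy_pos
  -- Nonnegativity of the gap at the saddle point bounds the distances from `a` to `x N` and from
  -- `b` to `c`.
  have h1 := hab.trans (hgap a ha b hb)
  refine (hgap u hu v hv).trans ?_
  have hshift : ∑ k ∈ Finset.range N, avgWeight ρ N k *
          (inner ℝ (gx k - gradX Φ (x k) (y (k + 1))) (u - x (k + 1))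
            - inner ℝ (gy k - gradY Φ (x k) (y k)) (v - y (k + 1)))
      = ∑ k ∈ Finset.range N, avgWeight ρ N k *
          (inner ℝ (gx k - gradX Φ (x k) (y (k + 1))) (a - x (k + 1))
            - inner ℝ (gy k - gradY Φ (x k) (y k)) (b - y (k + 1)))
        + inner ℝ (∑ k ∈ Finset.range N, avgWeight ρ N k • (gx k - gradX Φ (x k) (y (k + 1))))
            (u - a)
        - inner ℝ (∑ k ∈ Finset.range N, avgWeight ρ N k • (gy k - gradY Φ (x k) (y k)))
            (v - b) := by
    rw [sum_inner, sum_inner, ← Finset.sum_add_distrib, ← Finset.sum_sub_distrib]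
    refine Finset.sum_congr rfl fun k _ => ?_
    rw [real_inner_smul_left, real_inner_smul_left,
      show u - x (k + 1) = (a - x (k + 1)) + (u - a) by abel,
      show v - y (k + 1) = (b - y (k + 1)) + (v - b) by abel, inner_add_right, inner_add_right]
    ring
  rw [hshift]
  set t := tailRatio ρ N
  generalize ∑ k ∈ Finset.range N, avgWeight ρ N k *
          (inner ℝ (gx k - gradX Φ (x k) (y (k + 1))) (a - x (k + 1))
            - inner ℝ (gy k - gradY Φ (x k) (y k)) (b - y (k + 1))) = η at *
  generalize ∑ k ∈ Finset.range N, avgWeight ρ N k • (gx k - gradX Φ (x k) (y (k + 1))) = Mx at *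
  generalize ∑ k ∈ Finset.range N, avgWeight ρ N k • (gy k - gradY Φ (x k) (y k)) = My at *
  have hT : 0 < 1 + t := by linarith
  have i1 := inner_le_mul_sq_add_div Mx (u - x N) (mul_pos hT hμx)
  -- The Young parameter `λ = 7/10` balances the cost `1 + λ` of the saddle-point bound against the
  -- cost `(1 + 1/λ) / 2` of the averaged noise. With both noise budgets equal to `ε / 3` the
  -- optimum is `1/√2`. The resulting factors are `17/10` and `17/14`.
  have i2 := inner_le_mul_sq_add_div Mx (-(a - x N))
    (mul_pos (mul_pos (show (0 : ℝ) < 7 / 10 by norm_num) hT) hμx)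
  have i3 := inner_le_mul_sq_add_div My (-(v - c)) (mul_pos hT hμy)
  have i4 := inner_le_mul_sq_add_div My (b - c)
    (mul_pos (mul_pos (show (0 : ℝ) < 7 / 10 by norm_num) hT) hμy)
  rw [norm_neg] at i2 i3
  have e1 : inner ℝ Mx (u - a) = inner ℝ Mx (u - x N) + inner ℝ Mx (-(a - x N)) := by
    rw [← inner_add_right]
    congr 1
    abel
  have e2 : -inner ℝ My (v - b) = inner ℝ My (-(v - c)) + inner ℝ My (b - c) := by
    rw [← inner_add_right, ← inner_neg_right]
    congr 1
    abel
  have e3 : 17 / 14 * (1 + t)⁻¹ * (‖Mx‖ ^ 2 / μx + ‖My‖ ^ 2 / μy)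
      = ‖Mx‖ ^ 2 / (2 * ((1 + t) * μx)) + ‖Mx‖ ^ 2 / (2 * (7 / 10 * (1 + t) * μx))
        + (‖My‖ ^ 2 / (2 * ((1 + t) * μy)) + ‖My‖ ^ 2 / (2 * (7 / 10 * (1 + t) * μy))) := by
    field_simp
    ring
  rw [e3]
  linarith

end Path
end SaddlePoint
namespace SaddlePoint

/-! ### Saddle points and the primal-dual gap -/

section Gap

variable {E F : Type*} [NormedAddCommGroup E] [InnerProductSpace ℝ E] [CompleteSpace E]
  [NormedAddCommGroup F] [InnerProductSpace ℝ F] [CompleteSpace F]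
  {f : E → EReal} {g : F → EReal} {Φ : E → F → ℝ}
  {μx μy Lxx Lxy Lyx Lyy Ωf Ωg : ℝ}

lemma IsSmoothSaddle.isCompact_effDom_left (hS : IsSmoothSaddle f g Φ μx μy Lxx Lxy Lyx Lyy)
    (hc : HasCompactDomains f g Ωf Ωg) : IsCompact (effDom f) := by
  have h := hc.compact.image continuous_fst
  rwa [Set.fst_image_prod _ hS.g_convex.proper] at h

lemma IsSmoothSaddle.isCompact_effDom_right (hS : IsSmoothSaddle f g Φ μx μy Lxx Lxy Lyx Lyy)
    (hc : HasCompactDomains f g Ωf Ωg) : IsCompact (effDom g) := by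
  have h := hc.compact.image continuous_snd
  rwa [Set.snd_image_prod hS.f_convex.proper] at h

/-- Sion's theorem on the compact convex domains. The point is deterministic, so its correlation
with the noise can be estimated in expectation. -/
lemma IsSmoothSaddle.exists_saddle (hS : IsSmoothSaddle f g Φ μx μy Lxx Lxy Lyx Lyy)
    (hμx : 0 ≤ μx) (hμy : 0 ≤ μy) (hc : HasCompactDomains f g Ωf Ωg) :
    ∃ a ∈ effDom f, ∃ b ∈ effDom g,
      IsSaddlePointOn (effDom f) (effDom g) (realLagrangian f g Φ) a b := by
  have hF := hS.f_convex.convexOn_toReal hμx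
  have hG := hS.g_convex.convexOn_toReal hμy
  refine Sion.exists_isSaddlePointOn hS.f_convex.proper hF.1 (hS.isCompact_effDom_left hc)
    (fun y hy => ?_) (fun y hy => ?_) hG.1 hS.g_convex.proper (hS.isCompact_effDom_right hc)
    (fun x hx => ?_) (fun x hx => ?_)
  · have h := (hS.f_convex.lowerSemicontinuousOn_toReal.add
      ((hS.diff_x y hy).continuous.lowerSemicontinuous.lowerSemicontinuousOn _)).add
      (lowerSemicontinuousOn_const (z := -(g y).toReal))
    simpa only [realLagrangian, sub_eq_add_neg] using h
  · have h := ((hF.add ((hS.convex_x y hy).subset (Set.subset_univ _) hF.1)).add_const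
      (-(g y).toReal)).quasiconvexOn
    exact h
  · have h1 : UpperSemicontinuousOn (fun y => -(g y).toReal) (effDom g) :=
      continuous_neg.comp_lowerSemicontinuousOn_antitone
        hS.g_convex.lowerSemicontinuousOn_toReal (fun _ _ h => neg_le_neg h)
    have h := ((upperSemicontinuousOn_const (z := (f x).toReal)).add
      ((hS.diff_y x hx).continuous.upperSemicontinuous.upperSemicontinuousOn _)).add h1
    simpa only [realLagrangian, sub_eq_add_neg] using h
  · have h := ((((hS.concave_y x hx).subset (Set.subset_univ _) hG.1).add_const
      (f x).toReal).sub hG).quasiconcaveOn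
    convert! h using 2
    simp only [realLagrangian, Pi.add_apply, Pi.sub_apply]
    ring

/-- If `u` or `v` lies outside its domain, the difference of Lagrangians is `⊥`, so only real values
enter the supremum. -/
lemma primalDualGap_le (hS : IsSmoothSaddle f g Φ μx μy Lxx Lxy Lyx Lyy)
    {a : E} {b : F} (ha : a ∈ effDom f) (hb : b ∈ effDom g) {B : ℝ}
    (h : ∀ u ∈ effDom f, ∀ v ∈ effDom g,
      realLagrangian f g Φ a v - realLagrangian f g Φ u b ≤ B) :
    primalDualGap f g Φ a b ≤ (B : EReal) := by
  have hcoe : ∀ u ∈ effDom f, ∀ v ∈ effDom g,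
      lagrangian f g Φ u v = (realLagrangian f g Φ u v : ℝ) := by
    intro u hu v hv
    rw [lagrangian, realLagrangian, ← hS.f_convex.coe_toReal hu, ← hS.g_convex.coe_toReal hv,
      EReal.toReal_coe, EReal.toReal_coe]
    norm_cast
  refine iSup₂_le fun u v => ?_
  by_cases hv : v ∈ effDom g
  · rw [hcoe a ha v hv]
    by_cases hu : u ∈ effDom f
    · rw [hcoe u hu b hb]
      exact_mod_cast h u hu v hv
    · have hu' : f u = ⊤ := by simpa [effDom] using hu
      have : lagrangian f g Φ u b = ⊤ := by
        rw [lagrangian, hu', EReal.top_add_coe, ← hS.g_convex.coe_toReal hb, EReal.top_sub_coe]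
      rw [this, EReal.sub_top]
      exact bot_le
  · have hv' : g v = ⊤ := by simpa [effDom] using hv
    have : lagrangian f g Φ a v = ⊥ := by
      rw [lagrangian, hv', EReal.sub_top]
    rw [this, EReal.bot_sub]
    exact bot_le

end Gap

/-! ### The explicit parameters -/

section Parameters

variable {β₁ β₂ μx μy Lxx Lyx Lyy δx δy ε ρ : ℝ}

/-- The constant in the iteration complexity. -/
noncomputable def complexityConst (β₁ β₂ : ℝ) : ℝ :=
  7 + 1 / β₁ + 1 / (β₂ * (1 - β₁ - β₂)) + 6 / (1 - β₁ - β₂)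

/-- The condition number in the iteration complexity. -/
noncomputable def complexityNumber (μx μy Lxx Lyx Lyy δx δy ε : ℝ) : ℝ :=
  1 + Lxx / μx + Lyx ^ 2 / (μx * μy) + Lyy ^ 2 / μy ^ 2 + (δx ^ 2 / μx + δy ^ 2 / μy) * (1 / ε)

lemma condL_pos (hβ₁ : 0 < β₁) (hμx : 0 < μx) (hμy : 0 < μy) (hLxx : 0 ≤ Lxx) (hLyx : 0 < Lyx) :
    0 < condL β₁ β₂ μx μy Lxx Lyx Lyy :=
  lt_of_lt_of_le (by positivity) (le_max_left _ _)

lemma one_sub_rhoBar (hL : 0 < condL β₁ β₂ μx μy Lxx Lyx Lyy) :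
    1 - rhoBar β₁ β₂ μx μy Lxx Lyx Lyy = (1 + condL β₁ β₂ μx μy Lxx Lyx Lyy)⁻¹ := by
  rw [rhoBar]
  field_simp
  ring

lemma rhoSGDA_pos (hL : 0 < condL β₁ β₂ μx μy Lxx Lyx Lyy) :
    0 < rhoSGDA β₁ β₂ μx μy Lxx Lyx Lyy δx δy ε :=
  lt_of_lt_of_le (by rw [rhoBar]; positivity) (le_max_left _ _)

/-- `1 - ρ` is the smallest of the values given by the three rates, so each reciprocal must be
dominated. They are `1 + L` for the Lipschitz rate and, where the noise rates are positive, `6 δx² /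
(μx ε)` and at most `6 δy² / ((1 - β₁ - β₂) μy ε)`. The constant is a sum that covers all the
coefficients involved. -/
lemma one_le_one_sub_rhoSGDA_mul (hβ₁ : 0 < β₁) (hβ₂ : 0 < β₂) (hβ : β₁ + β₂ < 1)
    (hμx : 0 < μx) (hμy : 0 < μy) (hε : 0 < ε)
    (hLxx : 0 ≤ Lxx) (hLyx : 0 < Lyx) :
    1 ≤ (1 - rhoSGDA β₁ β₂ μx μy Lxx Lyx Lyy δx δy ε)
      * (complexityConst β₁ β₂ * complexityNumber μx μy Lxx Lyx Lyy δx δy ε) := by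
  have hc : 0 < 1 - β₁ - β₂ := by linarith
  have hL := condL_pos (β₂ := β₂) (Lyy := Lyy) hβ₁ hμx hμy hLxx hLyx
  set M := complexityConst β₁ β₂ * complexityNumber μx μy Lxx Lyx Lyy δx δy ε with hM
  have hA : 0 ≤ Lxx / μx := by positivity
  have hB : 0 ≤ Lyx ^ 2 / (μx * μy) := by positivity
  have hD : 0 ≤ Lyy ^ 2 / μy ^ 2 := by positivity
  have hX : 0 ≤ δx ^ 2 / μx := by positivity
  have hY : 0 ≤ δy ^ 2 / μy := by positivity
  have hε' : 0 < 1 / ε := by positivity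
  have hR1 : 1 ≤ complexityNumber μx μy Lxx Lyx Lyy δx δy ε := by
    rw [complexityNumber]
    nlinarith [mul_nonneg (add_nonneg hX hY) hε'.le]
  have hRX : δx ^ 2 / μx * (1 / ε) ≤ complexityNumber μx μy Lxx Lyx Lyy δx δy ε := by
    rw [complexityNumber]
    nlinarith [mul_nonneg hX hε'.le, mul_nonneg hY hε'.le]
  have hRY : δy ^ 2 / μy * (1 / ε) ≤ complexityNumber μx μy Lxx Lyx Lyy δx δy ε := by
    rw [complexityNumber]
    nlinarith [mul_nonneg hX hε'.le, mul_nonneg hY hε'.le]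
  have hRL : 1 + Lxx / μx + Lyx ^ 2 / (μx * μy) + Lyy ^ 2 / μy ^ 2
      ≤ complexityNumber μx μy Lxx Lyx Lyy δx δy ε := by
    rw [complexityNumber]
    nlinarith [mul_nonneg hX hε'.le, mul_nonneg hY hε'.le]
  have hb1 : 0 < 1 / β₁ := by positivity
  have hb2 : 0 < 1 / (β₂ * (1 - β₁ - β₂)) := by positivity
  have hb3 : 0 < 6 / (1 - β₁ - β₂) := by positivity
  have hle : ∀ {K r : ℝ}, K ≤ complexityConst β₁ β₂ → 0 ≤ K →
      r ≤ complexityNumber μx μy Lxx Lyx Lyy δx δy ε → K * r ≤ M := by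
    intro K r hK hK0 hr
    exact (mul_le_mul_of_nonneg_left hr hK0).trans
      (mul_le_mul_of_nonneg_right hK (by linarith))
  have hM1 : 1 ≤ M := by
    have := hle (K := 1) (by rw [complexityConst]; linarith) zero_le_one hR1
    linarith
  have h1 : 1 ≤ (1 - rhoBar β₁ β₂ μx μy Lxx Lyx Lyy) * M := by
    rw [one_sub_rhoBar hL, inv_mul_eq_div, le_div_iff₀ (by linarith), one_mul]
    refine le_trans ?_ (hle le_rfl (by rw [complexityConst]; linarith) hRL)
    have h2 : condL β₁ β₂ μx μy Lxx Lyx Lyy ≤ Lxx / μx + 1 / β₁ * (Lyx ^ 2 / (μx * μy))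
        + 1 / (β₂ * (1 - β₁ - β₂)) * (Lyy ^ 2 / μy ^ 2) := by
      rw [condL]
      refine max_le ?_ ?_
      · nlinarith [mul_nonneg hb2.le hD]
      · nlinarith [mul_nonneg hb1.le hB]
    rw [complexityConst]
    generalize Lxx / μx = A at *
    generalize Lyx ^ 2 / (μx * μy) = B at *
    generalize Lyy ^ 2 / μy ^ 2 = D at *
    generalize 1 / β₁ = p at *
    generalize 1 / (β₂ * (1 - β₁ - β₂)) = r at *
    generalize 6 / (1 - β₁ - β₂) = s at *
    have : 0 ≤ (p + r + s) * A + (r + s) * B + (p + s) * D + 6 * (A + B + D) + p + r + s + 6 := by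
      positivity
    linarith
  have h2 : 1 ≤ (1 - rhoNoiseX μx δx ε) * M := by
    rw [rhoNoiseX]
    split_ifs with h0
    · linarith
    · rcases max_choice 0 (1 - μx / (6 * δx ^ 2) * ε) with h | h <;> rw [h]
      · linarith
      · have hδ : 0 < δx ^ 2 := lt_of_le_of_ne (sq_nonneg _) (Ne.symm h0)
        have hδ0 : δx ≠ 0 := fun h => h0 (by rw [h]; ring)
        have h3 := hle (K := 6) (by rw [complexityConst]; linarith) (by norm_num) hRX
        have h4 : 1 - (1 - μx / (6 * δx ^ 2) * ε) = μx / (6 * δx ^ 2) * ε := by ring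
        rw [h4]
        calc (1 : ℝ) = μx / (6 * δx ^ 2) * ε * (6 * (δx ^ 2 / μx * (1 / ε))) := by field_simp
          _ ≤ _ := by gcongr
  have h3 : 1 ≤ (1 - rhoNoiseY β₁ β₂ μy δy ε) * M := by
    rw [rhoNoiseY]
    split_ifs with h0
    · linarith
    · push Not at h0
      rcases max_choice 0 ((6 * δy ^ 2 - ε * μy) / (6 * δy ^ 2 - ε * μy * (β₁ + β₂))) with h | h <;>
        rw [h]
      · linarith
      · have hden : 0 < 6 * δy ^ 2 - ε * μy * (β₁ + β₂) := by linarith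
        have h3 := hle (K := 6 / (1 - β₁ - β₂)) (by rw [complexityConst]; linarith) hb3.le hRY
        have h4 : 1 - (6 * δy ^ 2 - ε * μy) / (6 * δy ^ 2 - ε * μy * (β₁ + β₂))
            = ε * μy * (1 - β₁ - β₂) / (6 * δy ^ 2 - ε * μy * (β₁ + β₂)) := by
          field_simp
          ring
        rw [h4, div_mul_eq_mul_div, le_div_iff₀ hden, one_mul]
        calc 6 * δy ^ 2 - ε * μy * (β₁ + β₂) ≤ 6 * δy ^ 2 := by
              have : 0 ≤ ε * μy * (β₁ + β₂) := by positivity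
              linarith
          _ = ε * μy * (1 - β₁ - β₂) * (6 / (1 - β₁ - β₂) * (δy ^ 2 / μy * (1 / ε))) := by
              field_simp
          _ ≤ _ := by gcongr
  rw [rhoSGDA]
  rcases max_choice (rhoBar β₁ β₂ μx μy Lxx Lyx Lyy)
    (max (rhoNoiseX μx δx ε) (rhoNoiseY β₁ β₂ μy δy ε)) with h | h <;> rw [h]
  · exact h1
  · rcases max_choice (rhoNoiseX μx δx ε) (rhoNoiseY β₁ β₂ μy δy ε) with h | h <;> rw [h]
    · exact h2
    · exact h3

lemma complexity_pos (hβ₁ : 0 < β₁) (hβ₂ : 0 < β₂) (hβ : β₁ + β₂ < 1)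
    (hμx : 0 < μx) (hμy : 0 < μy) (hε : 0 < ε) (hLxx : 0 ≤ Lxx) :
    0 < complexityConst β₁ β₂ * complexityNumber μx μy Lxx Lyx Lyy δx δy ε := by
  have hc : 0 < 1 - β₁ - β₂ := by linarith
  rw [complexityConst, complexityNumber]
  positivity

lemma rhoSGDA_lt_one (hβ₁ : 0 < β₁) (hβ₂ : 0 < β₂) (hβ : β₁ + β₂ < 1)
    (hμx : 0 < μx) (hμy : 0 < μy) (hε : 0 < ε) (hLxx : 0 ≤ Lxx) (hLyx : 0 < Lyx) :
    rhoSGDA β₁ β₂ μx μy Lxx Lyx Lyy δx δy ε < 1 := by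
  have h1 := one_le_one_sub_rhoSGDA_mul (Lyy := Lyy) (δx := δx) (δy := δy)
    hβ₁ hβ₂ hβ hμx hμy hε hLxx hLyx
  have h2 := complexity_pos (Lyx := Lyx) (Lyy := Lyy) (δx := δx) (δy := δy)
    hβ₁ hβ₂ hβ hμx hμy hε hLxx
  have := pos_of_mul_pos_left (lt_of_lt_of_le one_pos h1) h2.le
  linarith

lemma isStepRule_rhoSGDA (hβ₁ : 0 < β₁) (hβ₂ : 0 < β₂) (hβ : β₁ + β₂ < 1)
    (hμx : 0 < μx) (hμy : 0 < μy) (hε : 0 < ε) (hLxx : 0 ≤ Lxx) (hLyx : 0 < Lyx)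
    {τ σ : ℝ} (hρ : ρ = rhoSGDA β₁ β₂ μx μy Lxx Lyx Lyy δx δy ε)
    (hτ : τ = (1 - ρ) / (μx * ρ)) (hσ : σ = 1 / (1 - β₁ - β₂) * ((1 - ρ) / (μy * ρ))) :
    IsStepRule β₁ β₂ μx μy Lxx Lyx Lyy τ σ ρ := by
  have hc : 0 < 1 - β₁ - β₂ := by linarith
  have hL := condL_pos (β₂ := β₂) (Lyy := Lyy) hβ₁ hμx hμy hLxx hLyx
  have hρ0 : 0 < ρ := hρ ▸ rhoSGDA_pos hL
  have hρ1 : ρ < 1 := hρ ▸ rhoSGDA_lt_one hβ₁ hβ₂ hβ hμx hμy hε hLxx hLyx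
  have h1ρ : 0 < 1 - ρ := by linarith
  have hbar : rhoBar β₁ β₂ μx μy Lxx Lyx Lyy ≤ ρ := hρ ▸ le_max_left _ _
  have hLρ : condL β₁ β₂ μx μy Lxx Lyx Lyy ≤ ρ / (1 - ρ) := by
    have h1 := one_sub_rhoBar hL
    have h2 : 1 - ρ ≤ (1 + condL β₁ β₂ μx μy Lxx Lyx Lyy)⁻¹ := by linarith
    have h3 := mul_le_mul_of_nonneg_right h2
      (show 0 ≤ 1 + condL β₁ β₂ μx μy Lxx Lyx Lyy by linarith)
    rw [inv_mul_cancel₀ (by linarith)] at h3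
    rw [le_div_iff₀ h1ρ]
    linarith
  refine ⟨hβ₁, hβ₂, hβ, hμx, hμy, hρ0, hρ1, hτ, hσ, ?_, ?_⟩
  · have h := mul_le_mul_of_nonneg_left ((le_max_left _ _).trans hLρ) hμx.le
    calc Lxx + Lyx ^ 2 / (β₁ * μy)
        = μx * (Lxx / μx + 1 / β₁ * (Lyx ^ 2 / (μx * μy))) := by field_simp
      _ ≤ μx * (ρ / (1 - ρ)) := h
      _ = 1 / τ := by
        rw [hτ]
        field_simp
  · have h := mul_le_mul_of_nonneg_left ((le_max_right _ _).trans hLρ)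
      (mul_pos hc hμy).le
    calc Lyy ^ 2 / (β₂ * μy)
        = (1 - β₁ - β₂) * μy * (1 / (β₂ * (1 - β₁ - β₂)) * (Lyy ^ 2 / μy ^ 2)) := by field_simp
      _ ≤ (1 - β₁ - β₂) * μy * (ρ / (1 - ρ)) := h
      _ = 1 / σ := by
        rw [hσ]
        field_simp

lemma noiseX_le (hμx : 0 < μx) (hε : 0 < ε) (hρ : rhoNoiseX μx δx ε ≤ ρ) :
    (1 - ρ) * δx ^ 2 / μx ≤ ε / 6 := by
  rw [rhoNoiseX] at hρ
  split_ifs at hρ with h0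
  · rw [h0]
    simp only [mul_zero, zero_div]
    positivity
  · have hδ : 0 < δx ^ 2 := lt_of_le_of_ne (sq_nonneg _) (Ne.symm h0)
    have hδ0 : δx ≠ 0 := fun h => h0 (by rw [h]; ring)
    have h1 := (le_max_right _ _).trans hρ
    have h2 : (1 - ρ) ≤ μx / (6 * δx ^ 2) * ε := by linarith
    rw [div_le_iff₀ hμx]
    calc (1 - ρ) * δx ^ 2 ≤ μx / (6 * δx ^ 2) * ε * δx ^ 2 := by gcongr
      _ = _ := by field_simp

/-- This is the inequality that `rhoNoiseY` solves for `ρ`. It is equivalent to `σ / (1 + σ μy) *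
δy² ≤ ε / 6` for the chosen `σ`, and it also implies the bound on the averaged noise. -/
lemma noiseY_mul_le (hβ : β₁ + β₂ < 1) (hμy : 0 < μy) (hε : 0 < ε) (hρ1 : ρ ≤ 1)
    (hρ : rhoNoiseY β₁ β₂ μy δy ε ≤ ρ) :
    6 * ((1 - ρ) * δy ^ 2) ≤ ε * μy * (1 - (β₁ + β₂) * ρ) := by
  rw [rhoNoiseY] at hρ
  have hεμ : 0 < ε * μy := by positivity
  split_ifs at hρ with h0
  · have h1 := mul_le_mul_of_nonneg_left h0 (show 0 ≤ 1 - ρ by linarith)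
    nlinarith
  · push Not at h0
    have h1 := (le_max_right _ _).trans hρ
    rw [div_le_iff₀ (by linarith)] at h1
    linarith

lemma noiseY_le (hβ₁ : 0 < β₁) (hβ₂ : 0 < β₂) (hβ : β₁ + β₂ < 1) (hμy : 0 < μy) (hε : 0 < ε)
    (hρ0 : 0 ≤ ρ) (hρ1 : ρ ≤ 1) (hρ : rhoNoiseY β₁ β₂ μy δy ε ≤ ρ) :
    (1 - ρ) * δy ^ 2 / μy ≤ ε / 6 := by
  have h := noiseY_mul_le hβ hμy hε hρ1 hρ
  have h1 : 0 ≤ ε * μy * ((β₁ + β₂) * ρ) := by positivity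
  rw [div_le_iff₀ hμy]
  linarith

/-- Since `log ρ⁻¹ ≥ 1 - ρ ≥ 1 / M`, the iteration count forces `ρ^{-N} ≥ (1 + W / ε) ^ 30`, and
Bernoulli's inequality bounds this below by `1 + 30 W / ε`. -/
lemma tailRatio_mul_le {N : ℕ} {W M : ℝ} (hρ : 0 < ρ) (hρ1 : ρ < 1) (hN : 1 ≤ N) (hε : 0 < ε)
    (hW : 0 ≤ W) (hM : 1 ≤ (1 - ρ) * M) (h : 30 * M * Real.log (W / ε + 1) ≤ N) :
    tailRatio ρ N * W ≤ ε / 30 := by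
  have hs : 0 ≤ W / ε := by positivity
  have hlog : 0 ≤ Real.log (W / ε + 1) := Real.log_nonneg (by linarith)
  have h1 : 30 * Real.log (W / ε + 1) ≤ N * Real.log ρ⁻¹ := by
    have h2 : 1 - ρ ≤ Real.log ρ⁻¹ := by
      rw [Real.log_inv]
      linarith [Real.log_le_sub_one_of_pos hρ]
    calc 30 * Real.log (W / ε + 1) ≤ (1 - ρ) * M * (30 * Real.log (W / ε + 1)) :=
          le_mul_of_one_le_left (by positivity) hM
      _ = (1 - ρ) * (30 * M * Real.log (W / ε + 1)) := by ring
      _ ≤ (1 - ρ) * N := mul_le_mul_of_nonneg_left h (by linarith)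
      _ ≤ Real.log ρ⁻¹ * N := by gcongr
      _ = _ := by ring
  have h3 : (W / ε + 1) ^ 30 ≤ (ρ ^ N)⁻¹ := by
    rw [← inv_pow, ← Real.log_le_log_iff (by positivity) (by positivity), Real.log_pow,
      Real.log_pow]
    exact_mod_cast h1
  have h4 : 1 + 30 * (W / ε) ≤ (ρ ^ N)⁻¹ := by
    refine le_trans ?_ h3
    have := one_add_mul_le_pow (show -2 ≤ W / ε by linarith) 30
    rw [add_comm (W / ε) 1]
    exact_mod_cast this
  have h5 : 0 < (ρ ^ N)⁻¹ - 1 := by linarith [one_lt_inv_pow hρ hρ1 hN]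
  rw [tailRatio, inv_mul_eq_div, div_le_iff₀ h5]
  have h6 : 30 * W ≤ ε * ((ρ ^ N)⁻¹ - 1) := by
    calc 30 * W = ε * (30 * (W / ε)) := by field_simp
      _ ≤ _ := by gcongr; linarith
  linarith

end Parameters
end SaddlePoint
namespace SaddlePoint

/-! ### Conditional expectations and independence -/

lemma integrable_inner_of_memLp_two {Ω H : Type*} {m₀ : MeasurableSpace Ω} {P : Measure Ω}
    [NormedAddCommGroup H] [InnerProductSpace ℝ H] {V W : Ω → H} (hV : MemLp V 2 P) (hW : MemLp W 2 P) :
    Integrable (fun w => inner ℝ (V w) (W w)) P := by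
  refine ((hV.integrable_norm_pow two_ne_zero).add (hW.integrable_norm_pow two_ne_zero)).mono'
    (hV.aestronglyMeasurable.inner hW.aestronglyMeasurable) (Filter.Eventually.of_forall fun w => ?_)
  have h := norm_inner_le_norm (𝕜 := ℝ) (V w) (W w)
  simp only [Pi.add_apply]
  nlinarith [sq_nonneg (‖V w‖ - ‖W w‖), sq_nonneg ‖V w‖, sq_nonneg ‖W w‖]

/-- Pythagoras in `L²`: the cross terms vanish by orthogonality. -/
lemma integral_norm_sq_sum_smul_le {Ω H : Type*} {m₀ : MeasurableSpace Ω} {P : Measure Ω}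
    [NormedAddCommGroup H] [InnerProductSpace ℝ H] {V : ℕ → Ω → H} (hV : ∀ k, MemLp (V k) 2 P)
    (horth : ∀ j k, j < k → ∫ w, inner ℝ (V k w) (V j w) ∂P = 0) {c : ℝ}
    (hc : ∀ k, ∫ w, ‖V k w‖ ^ 2 ∂P ≤ c) (a : ℕ → ℝ) (N : ℕ) :
    ∫ w, ‖∑ k ∈ Finset.range N, a k • V k w‖ ^ 2 ∂P ≤ (∑ k ∈ Finset.range N, a k ^ 2) * c := by
  have hsum : ∀ n, MemLp (fun w => ∑ k ∈ Finset.range n, a k • V k w) 2 P := fun n =>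
    memLp_finsetSum _ fun k _ => (hV k).const_smul (a k)
  induction N with
  | zero => simp
  | succ n ih =>
    have hVn := hV n
    have hin : Integrable (fun w => inner ℝ (∑ k ∈ Finset.range n, a k • V k w) (a n • V n w)) P :=
      integrable_inner_of_memLp_two (hsum n) (hVn.const_smul (a n))
    have h0 : ∫ w, inner ℝ (∑ k ∈ Finset.range n, a k • V k w) (a n • V n w) ∂P = 0 := by
      have e : ∀ w, inner ℝ (∑ k ∈ Finset.range n, a k • V k w) (a n • V n w)
          = ∑ k ∈ Finset.range n, a k * a n * inner ℝ (V n w) (V k w) := by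
        intro w
        rw [sum_inner]
        refine Finset.sum_congr rfl fun k _ => ?_
        rw [real_inner_smul_left, real_inner_smul_right, real_inner_comm]
        ring
      simp only [e]
      rw [integral_finsetSum _ fun k _ => (integrable_inner_of_memLp_two hVn (hV k)).const_mul _]
      refine Finset.sum_eq_zero fun k hk => ?_
      rw [integral_const_mul, horth k n (Finset.mem_range.1 hk), mul_zero]
    have e : ∀ w, ‖∑ k ∈ Finset.range (n + 1), a k • V k w‖ ^ 2
        = ‖∑ k ∈ Finset.range n, a k • V k w‖ ^ 2
          + 2 * inner ℝ (∑ k ∈ Finset.range n, a k • V k w) (a n • V n w)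
          + a n ^ 2 * ‖V n w‖ ^ 2 := by
      intro w
      rw [Finset.sum_range_succ, norm_add_sq_real, norm_smul, mul_pow, Real.norm_eq_abs, sq_abs]
    simp only [e]
    have i1 : Integrable (fun w => ‖∑ k ∈ Finset.range n, a k • V k w‖ ^ 2) P :=
      (hsum n).integrable_norm_pow two_ne_zero
    have i2 : Integrable (fun w => ‖V n w‖ ^ 2) P := hVn.integrable_norm_pow two_ne_zero
    have i3 : Integrable (fun w => ‖∑ k ∈ Finset.range n, a k • V k w‖ ^ 2
        + 2 * inner ℝ (∑ k ∈ Finset.range n, a k • V k w) (a n • V n w)) P :=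
      i1.add (hin.const_mul 2)
    rw [integral_add i3 (i2.const_mul _), integral_add i1 (hin.const_mul 2),
      integral_const_mul, integral_const_mul, h0, Finset.sum_range_succ, add_mul]
    have := mul_le_mul_of_nonneg_left (hc n) (sq_nonneg (a n))
    linarith

section Probability

variable {Ω : Type*} {m m₀ : MeasurableSpace Ω} {P : Measure Ω} [IsProbabilityMeasure P]

/-- The joint law of the three variables factorizes on boxes, which determine it. -/
lemma indepFun_prodMk_of_indepFun {α β γ : Type*} [MeasurableSpace α] [MeasurableSpace β]
    [MeasurableSpace γ] {A : Ω → α} {B : Ω → β} {C : Ω → γ} (hA : Measurable A)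
    (hB : Measurable B) (hC : Measurable C) (hBA : IndepFun B A P)
    (h : IndepFun (fun w => (B w, A w)) C P) : IndepFun (fun w => (B w, C w)) A P := by
  have hBC : IndepFun B C P := h.comp measurable_fst measurable_id
  rw [indepFun_iff_map_prod_eq_prod_map_map (hB.prodMk hC).aemeasurable hA.aemeasurable,
    Measure.ext_prod₃_iff']
  intro s t u hs ht hu
  rw [Measure.prod_prod, Measure.map_apply (by fun_prop) ((hs.prod ht).prod hu),
    Measure.map_apply (by fun_prop) (hs.prod ht), Measure.map_apply hA hu]
  have h1 := h.measure_inter_preimage_eq_mul (s ×ˢ u) t (hs.prod hu) ht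
  have h2 := hBA.measure_inter_preimage_eq_mul s u hs hu
  have h3 := hBC.measure_inter_preimage_eq_mul s t hs ht
  have e1 : (fun w => ((B w, C w), A w)) ⁻¹' ((s ×ˢ t) ×ˢ u)
      = (fun w => (B w, A w)) ⁻¹' (s ×ˢ u) ∩ C ⁻¹' t := by
    ext w
    simp only [Set.mem_preimage, Set.mem_prod, Set.mem_inter_iff]
    tauto
  have e2 : (fun w => (B w, A w)) ⁻¹' (s ×ˢ u) = B ⁻¹' s ∩ A ⁻¹' u := rfl
  have e3 : (fun w => (B w, C w)) ⁻¹' (s ×ˢ t) = B ⁻¹' s ∩ C ⁻¹' t := rfl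
  rw [e1, h1, e2, h2, e3, h3]
  ring

variable {H : Type*} [NormedAddCommGroup H]

lemma integral_norm_sq_le_of_condExp_le (hm : m ≤ m₀) {V : Ω → H} {c : ℝ}
    (h : P[fun w => ‖V w‖ ^ 2 | m] ≤ᵐ[P] fun _ => c) : ∫ w, ‖V w‖ ^ 2 ∂P ≤ c := by
  rw [← integral_condExp hm]
  refine (integral_mono_ae integrable_condExp (integrable_const c) h).trans ?_
  simp

variable [InnerProductSpace ℝ H] [CompleteSpace H]
  {𝒳 S : Type*} [MeasurableSpace 𝒳] [MeasurableSpace S] {X : Ω → 𝒳} {ξ : Ω → S}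

/-- Freezing lemma: the conditional expectation of `Γ X ξ` given a `σ`-algebra that makes `X`
measurable and is independent of `ξ` is obtained by integrating out `ξ`. -/
lemma condExp_comp_of_indep (hm : m ≤ m₀) (hξ : Measurable ξ)
    (hind : Indep m (MeasurableSpace.comap ξ inferInstance) P) (hX : Measurable[m] X)
    {Γ : 𝒳 × S → H} (hΓ : StronglyMeasurable Γ) (hint : Integrable (fun w => Γ (X w, ξ w)) P) :
    P[fun w => Γ (X w, ξ w) | m] =ᵐ[P] fun w => ∫ s, Γ (X w, s) ∂(P.map ξ) := by
  have hX' : Measurable X := hX.mono hm le_rfl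
  have hPξ : IsProbabilityMeasure (P.map ξ) := Measure.isProbabilityMeasure_map hξ.aemeasurable
  have hφ : StronglyMeasurable fun x => ∫ s, Γ (x, s) ∂(P.map ξ) := hΓ.integral_prod_right'
  have hprod : ∀ {𝒴 : Type _} [MeasurableSpace 𝒴] (Y : Ω → 𝒴), Measurable[m] Y →
      P.map (fun w => (Y w, ξ w)) = (P.map Y).prod (P.map ξ) := by
    intro 𝒴 _ Y hY
    have hYξ : IndepFun Y ξ P := indep_of_indep_of_le_left hind hY.comap_le
    exact (indepFun_iff_map_prod_eq_prod_map_map (hY.mono hm le_rfl).aemeasurable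
      hξ.aemeasurable).1 hYξ
  have hφint : Integrable (fun w => ∫ s, Γ (X w, s) ∂(P.map ξ)) P := by
    have h1 : Integrable Γ ((P.map X).prod (P.map ξ)) := by
      rw [← hprod X hX]
      exact (integrable_map_measure hΓ.aestronglyMeasurable (hX'.prodMk hξ).aemeasurable).2 hint
    exact (integrable_map_measure hφ.aestronglyMeasurable hX'.aemeasurable).1 h1.integral_prod_left
  symm
  refine ae_eq_condExp_of_forall_setIntegral_eq hm hint (fun s _ _ => hφint.integrableOn)
    (fun B hB _ => ?_) (hφ.comp_measurable hX).aestronglyMeasurable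
  have hB' : MeasurableSet B := hm B hB
  -- The test set is encoded as a variable: `(r, X)` is `m`-measurable, hence independent of `ξ`,
  -- and Fubini for the product law gives the set integral.
  let r : Ω → ℝ := B.indicator fun _ => 1
  have hr : Measurable[m] r := measurable_const.indicator hB
  have hr' : Measurable r := hr.mono hm le_rfl
  have hY : Measurable[m] fun w => (r w, X w) := hr.prodMk hX
  have hΨ : StronglyMeasurable fun p : (ℝ × 𝒳) × S => p.1.1 • Γ (p.1.2, p.2) :=
    (measurable_fst.comp measurable_fst).stronglyMeasurable.smul
      (hΓ.comp_measurable ((measurable_snd.comp measurable_fst).prodMk measurable_snd))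
  have hind_eq : ∀ F : Ω → H, ∫ w in B, F w ∂P = ∫ w, r w • F w ∂P := by
    intro F
    rw [← integral_indicator hB']
    congr 1
    ext w
    by_cases hw : w ∈ B <;> simp [r, hw]
  have hΨint : Integrable (fun p : (ℝ × 𝒳) × S => p.1.1 • Γ (p.1.2, p.2))
      ((P.map fun w => (r w, X w)).prod (P.map ξ)) := by
    rw [← hprod _ hY]
    refine (integrable_map_measure hΨ.aestronglyMeasurable (by fun_prop)).2 ?_
    have h1 : Integrable (fun w => r w • Γ (X w, ξ w)) P := by
      refine (hint.indicator hB').congr (Filter.Eventually.of_forall fun w => ?_)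
      by_cases hw : w ∈ B <;> simp [r, hw]
    exact h1
  rw [hind_eq, hind_eq]
  calc ∫ w, r w • ∫ s, Γ (X w, s) ∂(P.map ξ) ∂P
      = ∫ p, p.1 • (∫ s, Γ (p.2, s) ∂(P.map ξ)) ∂(P.map fun w => (r w, X w)) :=
        (integral_map (hY.mono hm le_rfl).aemeasurable (measurable_fst.stronglyMeasurable.smul
          (hφ.comp_measurable measurable_snd)).aestronglyMeasurable).symm
    _ = ∫ p, p.1.1 • Γ (p.1.2, p.2) ∂((P.map fun w => (r w, X w)).prod (P.map ξ)) := by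
        rw [integral_prod _ hΨint]
        simp only [integral_smul]
    _ = ∫ w, r w • Γ (X w, ξ w) ∂P := by
        rw [← hprod _ hY, integral_map (by fun_prop) hΨ.aestronglyMeasurable]

/-- An oracle with fresh randomness that is unbiased given its argument is unbiased given
the whole past. -/
lemma condExp_eq_of_indep (hm : m ≤ m₀) (hξ : Measurable ξ)
    (hind : Indep m (MeasurableSpace.comap ξ inferInstance) P) (hX : Measurable[m] X)
    {Γ : 𝒳 × S → H} (hΓ : StronglyMeasurable Γ) (hint : Integrable (fun w => Γ (X w, ξ w)) P)
    {D : Ω → H}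
    (hD : P[fun w => Γ (X w, ξ w) | MeasurableSpace.comap X inferInstance] =ᵐ[P] D) :
    P[fun w => Γ (X w, ξ w) | m] =ᵐ[P] D := by
  have h1 := condExp_comp_of_indep (hX.comap_le.trans hm) hξ
    (indep_of_indep_of_le_left hind hX.comap_le) (comap_measurable X) hΓ hint
  -- Conditioning on `m` and on `X` alone yields the same function of `X`.
  exact (condExp_comp_of_indep hm hξ hind hX hΓ hint).trans (h1.symm.trans hD)

lemma integral_inner_sub_condExp_eq_zero (hm : m ≤ m₀) {G D V : Ω → H}
    (hG : Integrable G P) (hD : P[G | m] =ᵐ[P] D) (hV : AEStronglyMeasurable[m] V P)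
    (hint : Integrable (fun w => inner ℝ (G w - D w) (V w)) P) :
    ∫ w, inner ℝ (G w - D w) (V w) ∂P = 0 := by
  have hDm : AEStronglyMeasurable[m] D P :=
    (stronglyMeasurable_condExp (f := G)).aestronglyMeasurable.congr hD
  have hDint : Integrable D P := (integrable_condExp (f := G)).congr hD
  have h0 : P[fun w => G w - D w | m] =ᵐ[P] 0 := by
    have h1 := condExp_sub hG hDint m
    have h2 := condExp_of_aestronglyMeasurable' hm hDm hDint
    filter_upwards [h1, h2, hD] with w h1 h2 h3
    change (P[G - D | m]) w = 0
    rw [h1, Pi.sub_apply, h2, h3, sub_self]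
  have h1 := condExp_bilin_of_aestronglyMeasurable_right (innerSL ℝ) (m := m) (μ := P)
    (f := fun w => G w - D w) (g := V) hV hint
    (hG.sub hDint)
  rw [← integral_condExp hm]
  have h2 : P[fun w => inner ℝ (G w - D w) (V w) | m] =ᵐ[P] 0 := by
    filter_upwards [h1, h0] with w h1 h0
    exact h1.trans (by rw [h0]; simp)
  rw [integral_congr_ae h2, integral_zero']

end Probability
end SaddlePoint
namespace SaddlePoint

/-! ### Noise along the iterates -/

/-- No measurability of the gradients is assumed. Along the iterates it is inherited from the
conditional expectation that they represent. -/
lemma aestronglyMeasurable_of_condExp_eq {Ω H : Type*} {m m₀ : MeasurableSpace Ω}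
    {P : Measure Ω} [NormedAddCommGroup H] [NormedSpace ℝ H] {G D : Ω → H}
    (hD : P[G | m] =ᵐ[P] D) :
    AEStronglyMeasurable[m] D P :=
  (stronglyMeasurable_condExp (f := G)).aestronglyMeasurable.congr hD

lemma memLp_two_sub_of_condExp_eq {Ω H : Type*} {m m₀ : MeasurableSpace Ω}
    {P : Measure Ω} [NormedAddCommGroup H] [NormedSpace ℝ H] (hm : m ≤ m₀) {G D : Ω → H} (hG : Integrable G P)
    (hD : P[G | m] =ᵐ[P] D) (hsq : Integrable (fun w => ‖G w - D w‖ ^ 2) P) :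
    MemLp (fun w => G w - D w) 2 P :=
  (memLp_two_iff_integrable_sq_norm (hG.aestronglyMeasurable.sub
    ((aestronglyMeasurable_of_condExp_eq hD).mono hm))).2 hsq

section Noise

variable {Ω : Type*} {m m₀ : MeasurableSpace Ω} {P : Measure Ω} [IsProbabilityMeasure P]

/-- The current sample of one sequence is independent of its own past together with the entire other
sequence. This makes the order of the two half-steps irrelevant. -/
lemma indepFun_past {S T : Type*} [MeasurableSpace S] [MeasurableSpace T] {α : ℕ → Ω → S}
    {β : ℕ → Ω → T} (hα : ∀ k, Measurable (α k)) (hβ : ∀ k, Measurable (β k))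
    (hind : iIndepFun α P) (hαβ : IndepFun (fun w k => α k w) (fun w k => β k w) P) (k : ℕ) :
    IndepFun (fun w => ((fun i : Finset.range k => α i w), fun i => β i w)) (α k) P := by
  refine indepFun_prodMk_of_indepFun (hα k) (by fun_prop) (by fun_prop) ?_ ?_
  · have h := hind.indepFun_finset (Finset.range k) {k} (by simp) hα
    exact h.comp measurable_id (measurable_pi_apply (⟨k, by simp⟩ : ({k} : Finset ℕ)))
  · have h := hαβ.comp (φ := fun s : ℕ → S => ((fun i : Finset.range k => s i), s k))
      (by fun_prop) measurable_id
    exact h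

variable {H : Type*} [NormedAddCommGroup H] [InnerProductSpace ℝ H] [CompleteSpace H]

/-- The error of a stochastic proximal step correlates with the oracle noise only through the
difference with the step along the exact direction. -/
lemma integral_inner_prox_noise_le (hm : m ≤ m₀) {h : H → EReal} {μ s c : ℝ}
    (hh : IsProperClosedConvex h μ) (hc : IsCompact (effDom h)) (hμ : 0 ≤ μ) (hs : 0 < s)
    {G D U : Ω → H} (hU : AEStronglyMeasurable[m] U P) (hG : Integrable G P)
    (hD : P[G | m] =ᵐ[P] D) (hsq : Integrable (fun w => ‖G w - D w‖ ^ 2) P)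
    (hvar : ∫ w, ‖G w - D w‖ ^ 2 ∂P ≤ c) (a : H) :
    Integrable (fun w => inner ℝ (G w - D w)
        (a - prox (fun v => (s : EReal) * h v) (U w - s • G w))) P ∧
      ∫ w, inner ℝ (G w - D w) (a - prox (fun v => (s : EReal) * h v) (U w - s • G w)) ∂P
        ≤ s / (1 + s * μ) * c := by
  have hcont := continuous_prox hh hc hμ hs
  have hmem := prox_mem hh hc hs
  have hlip := norm_prox_sub_prox_le hh hc hμ hs
  generalize prox (fun v => (s : EReal) * h v) = p at *
  obtain ⟨R, hR⟩ := hc.isBounded.exists_norm_le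
  have hDm := aestronglyMeasurable_of_condExp_eq hD
  have hLp := memLp_two_sub_of_condExp_eq hm hG hD hsq
  have hbdd : ∀ V : Ω → H, AEStronglyMeasurable V P → MemLp (fun w => a - p (V w)) 2 P := by
    intro V hV
    refine MemLp.of_bound (aestronglyMeasurable_const.sub (hcont.comp_aestronglyMeasurable hV))
      (‖a‖ + R) (Filter.Eventually.of_forall fun w => ?_)
    exact (norm_sub_le _ _).trans (add_le_add le_rfl (hR _ (hmem _)))
  have hI1 : Integrable (fun w => inner ℝ (G w - D w) (a - p (U w - s • G w))) P :=
    integrable_inner_of_memLp_two hLp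
      (hbdd _ ((hU.mono hm).sub (hG.aestronglyMeasurable.const_smul s)))
  have hVm : AEStronglyMeasurable[m] (fun w => U w - s • D w) P := hU.sub (hDm.const_smul s)
  have hI2 : Integrable (fun w => inner ℝ (G w - D w) (a - p (U w - s • D w))) P :=
    integrable_inner_of_memLp_two hLp (hbdd _ (hVm.mono hm))
  -- The step along the conditional mean `D` is `m`-measurable, hence uncorrelated with `G - D`.
  have h0 : ∫ w, inner ℝ (G w - D w) (a - p (U w - s • D w)) ∂P = 0 :=
    integral_inner_sub_condExp_eq_zero hm hG hD
      (aestronglyMeasurable_const.sub (hcont.comp_aestronglyMeasurable hVm)) hI2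
  have hden : 0 < 1 + s * μ := by positivity
  refine ⟨hI1, ?_⟩
  have hpt : ∀ w, inner ℝ (G w - D w) (a - p (U w - s • G w))
      ≤ inner ℝ (G w - D w) (a - p (U w - s • D w)) + s / (1 + s * μ) * ‖G w - D w‖ ^ 2 := by
    intro w
    have e : a - p (U w - s • G w) = (a - p (U w - s • D w))
        + (p (U w - s • D w) - p (U w - s • G w)) := by abel
    rw [e, inner_add_right]
    have h1 := real_inner_le_norm (G w - D w) (p (U w - s • D w) - p (U w - s • G w))
    have h2 := hlip (U w - s • D w) (U w - s • G w)
    have e2 : U w - s • D w - (U w - s • G w) = s • (G w - D w) := by module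
    rw [e2, norm_smul, Real.norm_of_nonneg hs.le] at h2
    have h3 : ‖p (U w - s • D w) - p (U w - s • G w)‖ ≤ s / (1 + s * μ) * ‖G w - D w‖ := by
      rw [div_mul_eq_mul_div, le_div_iff₀ hden, mul_comm]
      exact h2
    have h4 := mul_le_mul_of_nonneg_left h3 (norm_nonneg (G w - D w))
    linarith
  refine (integral_mono hI1 (hI2.add (hsq.const_mul _)) hpt).trans ?_
  simp only [Pi.add_apply]
  rw [integral_add hI2 (hsq.const_mul _), h0, zero_add, integral_const_mul]
  gcongr

end Noise

/-! ### The SGDA recursion and its measurability -/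

section Run

variable {E F S T Ω : Type*} [NormedAddCommGroup E] [InnerProductSpace ℝ E]
  [NormedAddCommGroup F] [InnerProductSpace ℝ F]

/-- The recursion of stochastic gradient descent ascent, pointwise in the sample. -/
structure IsSGDARun (f : E → EReal) (g : F → EReal) (Gx : E → F → S → E) (Gy : E → F → T → F)
    (τ σ : ℝ) (x₀ : E) (y₀ : F) (ωx : ℕ → Ω → S) (ωy : ℕ → Ω → T) (x : ℕ → Ω → E)
    (y : ℕ → Ω → F) : Prop where
  x_zero : ∀ w, x 0 w = x₀
  y_zero : ∀ w, y 0 w = y₀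
  y_succ : ∀ k w, y (k + 1) w
    = prox (fun v => (σ : EReal) * g v) (y k w + σ • Gy (x k w) (y k w) (ωy k w))
  x_succ : ∀ k w, x (k + 1) w
    = prox (fun v => (τ : EReal) * f v) (x k w - τ • Gx (x k w) (y (k + 1) w) (ωx k w))

variable {f : E → EReal} {g : F → EReal} {Gx : E → F → S → E} {Gy : E → F → T → F} {τ σ : ℝ}
  {x₀ : E} {y₀ : F} {ωx : ℕ → Ω → S} {ωy : ℕ → Ω → T} {x : ℕ → Ω → E} {y : ℕ → Ω → F}

lemma isSGDARun_sapd (f : E → EReal) (g : F → EReal) (Gx : E → F → S → E) (Gy : E → F → T → F)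
    (τ σ : ℝ) (x₀ : E) (y₀ : F) (ωx : ℕ → Ω → S) (ωy : ℕ → Ω → T) :
    IsSGDARun f g Gx Gy τ σ x₀ y₀ ωx ωy (sapdX f g Gx Gy τ σ 0 x₀ y₀ ωx ωy)
      (sapdY f g Gx Gy τ σ 0 x₀ y₀ ωx ωy) := by
  constructor <;> intros <;> simp [sapdX, sapdY, sapdState]

lemma IsSGDARun.measurable_y_succ [MeasurableSpace E] [BorelSpace E] [SecondCountableTopology E]
    [MeasurableSpace F] [BorelSpace F] [SecondCountableTopology F] [MeasurableSpace S]
    [MeasurableSpace T] {m : MeasurableSpace Ω}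
    (hrun : IsSGDARun f g Gx Gy τ σ x₀ y₀ ωx ωy x y)
    (hg : Continuous (prox fun v => (σ : EReal) * g v))
    (hGy : Measurable fun p : E × F × T => Gy p.1 p.2.1 p.2.2) {k : ℕ}
    (hx : Measurable (x k)) (hy : Measurable (y k)) (hωy : Measurable (ωy k)) :
    Measurable (y (k + 1)) := by
  rw [funext (hrun.y_succ k)]
  exact hg.measurable.comp (hy.add ((hGy.comp (hx.prodMk (hy.prodMk hωy))).const_smul σ))

/-- The `σ`-algebra is a parameter, so the lemma serves both for the ambient one and for the past:
the iterates with index `k` use only samples with index below `k`. -/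
lemma IsSGDARun.measurable [MeasurableSpace E] [BorelSpace E] [SecondCountableTopology E]
    [MeasurableSpace F] [BorelSpace F] [SecondCountableTopology F] [MeasurableSpace S]
    [MeasurableSpace T] {m : MeasurableSpace Ω}
    (hrun : IsSGDARun f g Gx Gy τ σ x₀ y₀ ωx ωy x y)
    (hf : Continuous (prox fun v => (τ : EReal) * f v))
    (hg : Continuous (prox fun v => (σ : EReal) * g v))
    (hGx : Measurable fun p : E × F × S => Gx p.1 p.2.1 p.2.2)
    (hGy : Measurable fun p : E × F × T => Gy p.1 p.2.1 p.2.2) :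
    ∀ k, (∀ i < k, Measurable (ωx i)) → (∀ i < k, Measurable (ωy i)) →
      Measurable (x k) ∧ Measurable (y k) := by
  intro k
  induction k with
  | zero =>
    intro _ _
    rw [funext hrun.x_zero, funext hrun.y_zero]
    exact ⟨measurable_const, measurable_const⟩
  | succ k ih =>
    intro hωx hωy
    obtain ⟨hx, hy⟩ := ih (fun i hi => hωx i (by omega)) (fun i hi => hωy i (by omega))
    have hy' := hrun.measurable_y_succ hg hGy hx hy (hωy k (by omega))
    refine ⟨?_, hy'⟩
    rw [funext (hrun.x_succ k)]
    exact hf.measurable.comp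
      (hx.sub ((hGx.comp (hx.prodMk (hy'.prodMk (hωx k (by omega))))).const_smul τ))

lemma IsSGDARun.isProxPath {μx μy : ℝ} (hrun : IsSGDARun f g Gx Gy τ σ x₀ y₀ ωx ωy x y)
    (hf : IsProperClosedConvex f μx) (hg : IsProperClosedConvex g μy)
    (hcf : IsCompact (effDom f)) (hcg : IsCompact (effDom g)) (hτ : 0 < τ) (hσ : 0 < σ)
    (hx₀ : x₀ ∈ effDom f) (hy₀ : y₀ ∈ effDom g) (w : Ω) :
    IsProxPath f g μx μy τ σ (fun k => x k w) (fun k => y k w)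
      (fun k => Gx (x k w) (y (k + 1) w) (ωx k w)) (fun k => Gy (x k w) (y k w) (ωy k w)) := by
  refine ⟨fun k => ?_, fun k => ?_, fun k v hv => ?_, fun k v hv => ?_⟩
  · cases k with
    | zero => rwa [hrun.x_zero]
    | succ k => rw [hrun.x_succ]; exact prox_mem hf hcf hτ _
  · cases k with
    | zero => rwa [hrun.y_zero]
    | succ k => rw [hrun.y_succ]; exact prox_mem hg hcg hσ _
  · have h := prox_optimality hf hcf hτ (x k w - τ • Gx (x k w) (y (k + 1) w) (ωx k w)) hv
    rwa [← hrun.x_succ] at h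
  · have h := prox_optimality hg hcg hσ (y k w + σ • Gy (x k w) (y k w) (ωy k w)) hv
    rwa [← hrun.y_succ] at h

end Run
end SaddlePoint
namespace SaddlePoint

/-! ### Noise estimates for the oracles and the expected gap -/

section Oracle

variable {E F S T Ω : Type*}
  [NormedAddCommGroup E] [InnerProductSpace ℝ E] [CompleteSpace E] [SecondCountableTopology E]
  [MeasurableSpace E] [BorelSpace E]
  [NormedAddCommGroup F] [InnerProductSpace ℝ F] [CompleteSpace F] [SecondCountableTopology F]
  [MeasurableSpace F] [BorelSpace F]
  [MeasurableSpace S] [MeasurableSpace T] [MeasurableSpace Ω] {P : Measure Ω}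
  {f : E → EReal} {g : F → EReal} {Φ : E → F → ℝ} {Gx : E → F → S → E} {Gy : E → F → T → F}
  {ωx : ℕ → Ω → S} {ωy : ℕ → Ω → T} {x : ℕ → Ω → E} {y : ℕ → Ω → F}
  {δx δy τ σ : ℝ} {x₀ : E} {y₀ : F}

lemma IsUnbiasedOracle.measurable_iterates (hO : IsUnbiasedOracle P Φ Gx Gy ωx ωy x y δx δy)
    (hrun : IsSGDARun f g Gx Gy τ σ x₀ y₀ ωx ωy x y)
    (hf : Continuous (prox fun v => (τ : EReal) * f v))
    (hg : Continuous (prox fun v => (σ : EReal) * g v)) (k : ℕ) :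
    Measurable (x k) ∧ Measurable (y k) :=
  hrun.measurable hf hg hO.measurable_Gx hO.measurable_Gy k (fun i _ => hO.measurable_ωx i)
    (fun i _ => hO.measurable_ωy i)

variable [IsProbabilityMeasure P]

/-- Conditioning is on the `x`-samples before `k` and all `y`-samples. This makes `(x k, y (k + 1))`
and the earlier noise measurable, while `ωx k` remains fresh. -/
lemma IsUnbiasedOracle.integral_inner_noiseX_eq_zero
    (hO : IsUnbiasedOracle P Φ Gx Gy ωx ωy x y δx δy)
    (hrun : IsSGDARun f g Gx Gy τ σ x₀ y₀ ωx ωy x y)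
    (hf : Continuous (prox fun v => (τ : EReal) * f v))
    (hg : Continuous (prox fun v => (σ : EReal) * g v)) {j k : ℕ} (hjk : j < k)
    (hint : Integrable (fun w => inner ℝ
      (Gx (x k w) (y (k + 1) w) (ωx k w) - gradX Φ (x k w) (y (k + 1) w))
      (Gx (x j w) (y (j + 1) w) (ωx j w) - gradX Φ (x j w) (y (j + 1) w))) P) :
    ∫ w, inner ℝ (Gx (x k w) (y (k + 1) w) (ωx k w) - gradX Φ (x k w) (y (k + 1) w))
      (Gx (x j w) (y (j + 1) w) (ωx j w) - gradX Φ (x j w) (y (j + 1) w)) ∂P = 0 := by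
  let Z : Ω → (Finset.range k → S) × (ℕ → T) := fun w => (fun i => ωx i w, fun i => ωy i w)
  have hZ : Measurable Z := by
    have := hO.measurable_ωx
    have := hO.measurable_ωy
    fun_prop
  have hind : IndepFun Z (ωx k) P :=
    indepFun_past hO.measurable_ωx hO.measurable_ωy hO.indep_ωx hO.indep_ωx_ωy k
  have hωx : ∀ i < k, Measurable[MeasurableSpace.comap Z inferInstance] (ωx i) := fun i hi =>
    (measurable_pi_apply (⟨i, Finset.mem_range.2 hi⟩ : Finset.range k)).comp
      (measurable_fst.comp (comap_measurable Z))
  have hωy : ∀ i, Measurable[MeasurableSpace.comap Z inferInstance] (ωy i) := fun i =>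
    (measurable_pi_apply i).comp (measurable_snd.comp (comap_measurable Z))
  have hX : ∀ i ≤ k, Measurable[MeasurableSpace.comap Z inferInstance]
      (fun w => (x i w, y (i + 1) w)) := by
    intro i hi
    obtain ⟨hx, hy⟩ := hrun.measurable
      (m := MeasurableSpace.comap Z inferInstance) hf hg hO.measurable_Gx hO.measurable_Gy i
      (fun l hl => hωx l (by omega)) (fun l _ => hωy l)
    exact hx.prodMk (hrun.measurable_y_succ
      (m := MeasurableSpace.comap Z inferInstance) hg hO.measurable_Gy hx hy (hωy i))
  have hΓ : StronglyMeasurable fun p : (E × F) × S => Gx p.1.1 p.1.2 p.2 :=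
    (hO.measurable_Gx.comp ((measurable_fst.comp measurable_fst).prodMk
      ((measurable_snd.comp measurable_fst).prodMk measurable_snd))).stronglyMeasurable
  have hcond := condExp_eq_of_indep
    (m := MeasurableSpace.comap Z inferInstance) hZ.comap_le (hO.measurable_ωx k) hind (hX k le_rfl) hΓ
    (hO.integrable_x k) (hO.unbiased_x k)
  refine integral_inner_sub_condExp_eq_zero hZ.comap_le (hO.integrable_x k) hcond ?_ hint
  refine AEStronglyMeasurable.sub ?_ ?_
  · exact (hΓ.comp_measurable ((hX j hjk.le).prodMk (hωx j hjk))).aestronglyMeasurable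
  · exact (aestronglyMeasurable_of_condExp_eq (hO.unbiased_x j)).mono (hX j hjk.le).comap_le

lemma IsUnbiasedOracle.integral_inner_noiseY_eq_zero
    (hO : IsUnbiasedOracle P Φ Gx Gy ωx ωy x y δx δy)
    (hrun : IsSGDARun f g Gx Gy τ σ x₀ y₀ ωx ωy x y)
    (hf : Continuous (prox fun v => (τ : EReal) * f v))
    (hg : Continuous (prox fun v => (σ : EReal) * g v)) {j k : ℕ} (hjk : j < k)
    (hint : Integrable (fun w => inner ℝ
      (Gy (x k w) (y k w) (ωy k w) - gradY Φ (x k w) (y k w))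
      (Gy (x j w) (y j w) (ωy j w) - gradY Φ (x j w) (y j w))) P) :
    ∫ w, inner ℝ (Gy (x k w) (y k w) (ωy k w) - gradY Φ (x k w) (y k w))
      (Gy (x j w) (y j w) (ωy j w) - gradY Φ (x j w) (y j w)) ∂P = 0 := by
  let Z : Ω → (Finset.range k → T) × (ℕ → S) := fun w => (fun i => ωy i w, fun i => ωx i w)
  have hZ : Measurable Z := by
    have := hO.measurable_ωx
    have := hO.measurable_ωy
    fun_prop
  have hind : IndepFun Z (ωy k) P :=
    indepFun_past hO.measurable_ωy hO.measurable_ωx hO.indep_ωy hO.indep_ωx_ωy.symm k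
  have hωy : ∀ i < k, Measurable[MeasurableSpace.comap Z inferInstance] (ωy i) := fun i hi =>
    (measurable_pi_apply (⟨i, Finset.mem_range.2 hi⟩ : Finset.range k)).comp
      (measurable_fst.comp (comap_measurable Z))
  have hωx : ∀ i, Measurable[MeasurableSpace.comap Z inferInstance] (ωx i) := fun i =>
    (measurable_pi_apply i).comp (measurable_snd.comp (comap_measurable Z))
  have hX : ∀ i ≤ k, Measurable[MeasurableSpace.comap Z inferInstance]
      (fun w => (x i w, y i w)) := by
    intro i hi
    obtain ⟨hx, hy⟩ := hrun.measurable
      (m := MeasurableSpace.comap Z inferInstance) hf hg hO.measurable_Gx hO.measurable_Gy i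
      (fun l _ => hωx l) (fun l hl => hωy l (by omega))
    exact hx.prodMk hy
  have hΓ : StronglyMeasurable fun p : (E × F) × T => Gy p.1.1 p.1.2 p.2 :=
    (hO.measurable_Gy.comp ((measurable_fst.comp measurable_fst).prodMk
      ((measurable_snd.comp measurable_fst).prodMk measurable_snd))).stronglyMeasurable
  have hcond := condExp_eq_of_indep
    (m := MeasurableSpace.comap Z inferInstance) hZ.comap_le (hO.measurable_ωy k) hind (hX k le_rfl) hΓ
    (hO.integrable_y k) (hO.unbiased_y k)
  refine integral_inner_sub_condExp_eq_zero hZ.comap_le (hO.integrable_y k) hcond ?_ hint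
  refine AEStronglyMeasurable.sub ?_ ?_
  · exact (hΓ.comp_measurable ((hX j hjk.le).prodMk (hωy j hjk))).aestronglyMeasurable
  · exact (aestronglyMeasurable_of_condExp_eq (hO.unbiased_y j)).mono (hX j hjk.le).comap_le

/-- The averaged noise in the `x`-gradients is square integrable with small variance. -/
lemma IsUnbiasedOracle.averaged_noiseX_le (hO : IsUnbiasedOracle P Φ Gx Gy ωx ωy x y δx δy)
    (hrun : IsSGDARun f g Gx Gy τ σ x₀ y₀ ωx ωy x y)
    (hf : Continuous (prox fun v => (τ : EReal) * f v))
    (hg : Continuous (prox fun v => (σ : EReal) * g v)) (a : ℕ → ℝ) (N : ℕ) :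
    Integrable (fun w => ‖∑ k ∈ Finset.range N, a k •
        (Gx (x k w) (y (k + 1) w) (ωx k w) - gradX Φ (x k w) (y (k + 1) w))‖ ^ 2) P ∧
      ∫ w, ‖∑ k ∈ Finset.range N, a k •
        (Gx (x k w) (y (k + 1) w) (ωx k w) - gradX Φ (x k w) (y (k + 1) w))‖ ^ 2 ∂P
        ≤ (∑ k ∈ Finset.range N, a k ^ 2) * δx ^ 2 := by
  have hm : ∀ k, MeasurableSpace.comap (fun w => (x k w, y (k + 1) w)) inferInstance
      ≤ (inferInstance : MeasurableSpace Ω) := fun k =>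
    ((hO.measurable_iterates hrun hf hg k).1.prodMk
      (hO.measurable_iterates hrun hf hg (k + 1)).2).comap_le
  have hV : ∀ k, MemLp (fun w =>
      Gx (x k w) (y (k + 1) w) (ωx k w) - gradX Φ (x k w) (y (k + 1) w)) 2 P := fun k =>
    memLp_two_sub_of_condExp_eq (hm k) (hO.integrable_x k) (hO.unbiased_x k) (hO.integrable_sq_x k)
  refine ⟨(memLp_finsetSum _ fun k _ => (hV k).const_smul (a k)).integrable_norm_pow two_ne_zero,
    integral_norm_sq_sum_smul_le hV (fun j k hjk => ?_) (fun k => ?_) a N⟩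
  · exact hO.integral_inner_noiseX_eq_zero hrun hf hg hjk
      (integrable_inner_of_memLp_two (hV k) (hV j))
  · exact integral_norm_sq_le_of_condExp_le (hm k) (hO.variance_x k)

/-- The averaged noise in the `y`-gradients is square integrable with small variance. -/
lemma IsUnbiasedOracle.averaged_noiseY_le (hO : IsUnbiasedOracle P Φ Gx Gy ωx ωy x y δx δy)
    (hrun : IsSGDARun f g Gx Gy τ σ x₀ y₀ ωx ωy x y)
    (hf : Continuous (prox fun v => (τ : EReal) * f v))
    (hg : Continuous (prox fun v => (σ : EReal) * g v)) (a : ℕ → ℝ) (N : ℕ) :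
    Integrable (fun w => ‖∑ k ∈ Finset.range N, a k •
        (Gy (x k w) (y k w) (ωy k w) - gradY Φ (x k w) (y k w))‖ ^ 2) P ∧
      ∫ w, ‖∑ k ∈ Finset.range N, a k •
        (Gy (x k w) (y k w) (ωy k w) - gradY Φ (x k w) (y k w))‖ ^ 2 ∂P
        ≤ (∑ k ∈ Finset.range N, a k ^ 2) * δy ^ 2 := by
  have hm : ∀ k, MeasurableSpace.comap (fun w => (x k w, y k w)) inferInstance
      ≤ (inferInstance : MeasurableSpace Ω) := fun k =>
    ((hO.measurable_iterates hrun hf hg k).1.prodMk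
      (hO.measurable_iterates hrun hf hg k).2).comap_le
  have hV : ∀ k, MemLp (fun w =>
      Gy (x k w) (y k w) (ωy k w) - gradY Φ (x k w) (y k w)) 2 P := fun k =>
    memLp_two_sub_of_condExp_eq (hm k) (hO.integrable_y k) (hO.unbiased_y k) (hO.integrable_sq_y k)
  refine ⟨(memLp_finsetSum _ fun k _ => (hV k).const_smul (a k)).integrable_norm_pow two_ne_zero,
    integral_norm_sq_sum_smul_le hV (fun j k hjk => ?_) (fun k => ?_) a N⟩
  · exact hO.integral_inner_noiseY_eq_zero hrun hf hg hjk
      (integrable_inner_of_memLp_two (hV k) (hV j))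
  · exact integral_norm_sq_le_of_condExp_le (hm k) (hO.variance_y k)

lemma IsUnbiasedOracle.integral_inner_noiseX_le
    (hO : IsUnbiasedOracle P Φ Gx Gy ωx ωy x y δx δy)
    (hrun : IsSGDARun f g Gx Gy τ σ x₀ y₀ ωx ωy x y) {μx : ℝ}
    (hf : IsProperClosedConvex f μx) (hcf : IsCompact (effDom f)) (hμx : 0 ≤ μx) (hτ : 0 < τ)
    (hg : Continuous (prox fun v => (σ : EReal) * g v)) (a : E) (k : ℕ) :
    Integrable (fun w => inner ℝ (Gx (x k w) (y (k + 1) w) (ωx k w)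
        - gradX Φ (x k w) (y (k + 1) w)) (a - x (k + 1) w)) P ∧
      ∫ w, inner ℝ (Gx (x k w) (y (k + 1) w) (ωx k w)
        - gradX Φ (x k w) (y (k + 1) w)) (a - x (k + 1) w) ∂P ≤ τ / (1 + τ * μx) * δx ^ 2 := by
  have hfc := continuous_prox hf hcf hμx hτ
  have hm := ((hO.measurable_iterates hrun hfc hg k).1.prodMk
    (hO.measurable_iterates hrun hfc hg (k + 1)).2).comap_le
  have hU : Measurable[MeasurableSpace.comap (fun w => (x k w, y (k + 1) w)) inferInstance]
      (x k) := measurable_fst.comp (comap_measurable (fun w => (x k w, y (k + 1) w)))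
  have h := integral_inner_prox_noise_le hm hf hcf hμx hτ hU.stronglyMeasurable.aestronglyMeasurable
    (hO.integrable_x k) (hO.unbiased_x k) (hO.integrable_sq_x k)
    (integral_norm_sq_le_of_condExp_le hm (hO.variance_x k)) a
  simpa only [← hrun.x_succ] using h

lemma IsUnbiasedOracle.integral_inner_noiseY_le
    (hO : IsUnbiasedOracle P Φ Gx Gy ωx ωy x y δx δy)
    (hrun : IsSGDARun f g Gx Gy τ σ x₀ y₀ ωx ωy x y) {μy : ℝ}
    (hg : IsProperClosedConvex g μy) (hcg : IsCompact (effDom g)) (hμy : 0 ≤ μy) (hσ : 0 < σ)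
    (hf : Continuous (prox fun v => (τ : EReal) * f v)) (b : F) (k : ℕ) :
    Integrable (fun w => inner ℝ (Gy (x k w) (y k w) (ωy k w)
        - gradY Φ (x k w) (y k w)) (b - y (k + 1) w)) P ∧
      -∫ w, inner ℝ (Gy (x k w) (y k w) (ωy k w)
        - gradY Φ (x k w) (y k w)) (b - y (k + 1) w) ∂P ≤ σ / (1 + σ * μy) * δy ^ 2 := by
  have hgc := continuous_prox hg hcg hμy hσ
  have hm := ((hO.measurable_iterates hrun hf hgc k).1.prodMk
    (hO.measurable_iterates hrun hf hgc k).2).comap_le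
  have hU : Measurable[MeasurableSpace.comap (fun w => (x k w, y k w)) inferInstance]
      (y k) := measurable_snd.comp (comap_measurable (fun w => (x k w, y k w)))
  have hneg : ∀ w, ‖-Gy (x k w) (y k w) (ωy k w) - -gradY Φ (x k w) (y k w)‖
      = ‖Gy (x k w) (y k w) (ωy k w) - gradY Φ (x k w) (y k w)‖ := by
    intro w
    rw [neg_sub_neg, norm_sub_rev]
  -- The dual step is an ascent step, so the lemma is applied to the negated oracle.
  have h := integral_inner_prox_noise_le (G := fun w => -Gy (x k w) (y k w) (ωy k w))
    (D := fun w => -gradY Φ (x k w) (y k w)) (c := δy ^ 2) hm hg hcg hμy hσ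
    hU.stronglyMeasurable.aestronglyMeasurable (hO.integrable_y k).neg
    ((condExp_neg _ _).trans (hO.unbiased_y k).neg)
    (by simpa only [hneg] using hO.integrable_sq_y k)
    (by simpa only [hneg] using integral_norm_sq_le_of_condExp_le hm (hO.variance_y k)) b
  have e : ∀ w, inner ℝ (-Gy (x k w) (y k w) (ωy k w) - -gradY Φ (x k w) (y k w))
      (b - prox (fun v => (σ : EReal) * g v) (y k w - σ • -Gy (x k w) (y k w) (ωy k w)))
      = -inner ℝ (Gy (x k w) (y k w) (ωy k w) - gradY Φ (x k w) (y k w)) (b - y (k + 1) w) := by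
    intro w
    have e1 : y k w - σ • -Gy (x k w) (y k w) (ωy k w)
        = y k w + σ • Gy (x k w) (y k w) (ωy k w) := by rw [smul_neg, sub_neg_eq_add]
    rw [e1, ← hrun.y_succ, ← inner_neg_left]
    congr 1
    abel
  simp only [e, integral_neg] at h
  exact ⟨by simpa using h.1.neg, h.2⟩

/-- The expected gap of the averaged iterates, for step sizes whose noise levels are small
compared with `ε` and after enough iterations. -/
lemma expectedGap_le {β₁ β₂ μx μy Lxx Lxy Lyx Lyy Ωf Ωg ρ ε : ℝ}
    (hS : IsSmoothSaddle f g Φ μx μy Lxx Lxy Lyx Lyy)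
    (hr : IsStepRule β₁ β₂ μx μy Lxx Lyx Lyy τ σ ρ) (hc : HasCompactDomains f g Ωf Ωg)
    (hx₀ : x₀ ∈ effDom f) (hy₀ : y₀ ∈ effDom g)
    (hO : IsUnbiasedOracle P Φ Gx Gy ωx ωy x y δx δy)
    (hrun : IsSGDARun f g Gx Gy τ σ x₀ y₀ ωx ωy x y) {N : ℕ} (hN : 1 ≤ N) (hε : 0 < ε)
    (htail : tailRatio ρ N * (μx * Ωf + μy * Ωg) ≤ ε / 30)
    (hnx : (1 - ρ) * δx ^ 2 / μx ≤ ε / 6) (hny : (1 - ρ) * δy ^ 2 / μy ≤ ε / 6)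
    (hcx : τ / (1 + τ * μx) * δx ^ 2 ≤ ε / 6) (hcy : σ / (1 + σ * μy) * δy ^ 2 ≤ ε / 6) :
    expectedGap P f g Φ (weightedAvg ρ x N) (weightedAvg ρ y N) ≤ ENNReal.ofReal ε := by
  have hμx := hr.μx_pos
  have hμy := hr.μy_pos
  have hcf := hS.isCompact_effDom_left hc
  have hcg := hS.isCompact_effDom_right hc
  have hfc := continuous_prox hS.f_convex hcf hμx.le hr.τ_pos
  have hgc := continuous_prox hS.g_convex hcg hμy.le hr.σ_pos
  obtain ⟨a, ha, b, hb, hab⟩ := hS.exists_saddle hμx.le hμy.le hc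
  have hpath := fun w => hrun.isProxPath hS.f_convex hS.g_convex hcf hcg hr.τ_pos hr.σ_pos hx₀ hy₀ w
  have hw := fun k => avgWeight_nonneg (N := N) hr.ρ_pos k
  have hw1 := sum_avgWeight hr.ρ_pos hN
  have ht := tailRatio_pos hr.ρ_pos hr.ρ_lt_one hN
  have hxmem : ∀ w, (∑ k ∈ Finset.range N, avgWeight ρ N k • x (k + 1) w) ∈ effDom f := fun w =>
    hS.f_convex.convex.1.sum_mem (fun k _ => hw k) hw1 fun k _ => (hpath w).mem_x (k + 1)
  have hymem : ∀ w, (∑ k ∈ Finset.range N, avgWeight ρ N k • y (k + 1) w) ∈ effDom g := fun w =>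
    hS.g_convex.convex.1.sum_mem (fun k _ => hw k) hw1 fun k _ => (hpath w).mem_y (k + 1)
  have hsad : ∀ w, 0 ≤
      realLagrangian f g Φ (∑ k ∈ Finset.range N, avgWeight ρ N k • x (k + 1) w) b
        - realLagrangian f g Φ a (∑ k ∈ Finset.range N, avgWeight ρ N k • y (k + 1) w) := fun w =>
    sub_nonneg.2 (hab _ (hxmem w) _ (hymem w))
  let η : Ω → ℝ := fun w => ∑ k ∈ Finset.range N, avgWeight ρ N k *
    (inner ℝ (Gx (x k w) (y (k + 1) w) (ωx k w) - gradX Φ (x k w) (y (k + 1) w)) (a - x (k + 1) w)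
      - inner ℝ (Gy (x k w) (y k w) (ωy k w) - gradY Φ (x k w) (y k w)) (b - y (k + 1) w))
  let Mx : Ω → ℝ := fun w => ‖∑ k ∈ Finset.range N, avgWeight ρ N k •
    (Gx (x k w) (y (k + 1) w) (ωx k w) - gradX Φ (x k w) (y (k + 1) w))‖ ^ 2
  let My : Ω → ℝ := fun w => ‖∑ k ∈ Finset.range N, avgWeight ρ N k •
    (Gy (x k w) (y k w) (ωy k w) - gradY Φ (x k w) (y k w))‖ ^ 2
  let B : Ω → ℝ := fun w => 17 / 10 * (tailRatio ρ N / 2 * (μx * Ωf + μy * Ωg) + η w)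
    + 17 / 14 * (1 + tailRatio ρ N)⁻¹ * (Mx w / μx + My w / μy)
  have hgap : ∀ w, ∀ u ∈ effDom f, ∀ v ∈ effDom g,
      realLagrangian f g Φ (∑ k ∈ Finset.range N, avgWeight ρ N k • x (k + 1) w) v
        - realLagrangian f g Φ u (∑ k ∈ Finset.range N, avgWeight ρ N k • y (k + 1) w) ≤ B w :=
    fun w u hu v hv => (hpath w).gap_le hS hr hc hN ha hb (hsad w) hu hv
  have hB0 : ∀ w, 0 ≤ B w := fun w => (hsad w).trans (hgap w a ha b hb)
  have hX := fun k => hO.integral_inner_noiseX_le hrun hS.f_convex hcf hμx.le hr.τ_pos hgc a k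
  have hY := fun k => hO.integral_inner_noiseY_le hrun hS.g_convex hcg hμy.le hr.σ_pos hfc b k
  obtain ⟨hMx, hMx'⟩ := hO.averaged_noiseX_le hrun hfc hgc (avgWeight ρ N) N
  obtain ⟨hMy, hMy'⟩ := hO.averaged_noiseY_le hrun hfc hgc (avgWeight ρ N) N
  have hterm : ∀ k, Integrable (fun w => avgWeight ρ N k *
      (inner ℝ (Gx (x k w) (y (k + 1) w) (ωx k w) - gradX Φ (x k w) (y (k + 1) w))
          (a - x (k + 1) w)
        - inner ℝ (Gy (x k w) (y k w) (ωy k w) - gradY Φ (x k w) (y k w)) (b - y (k + 1) w))) P :=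
    fun k => ((hX k).1.sub (hY k).1).const_mul _
  have hη : Integrable η P := integrable_finsetSum _ fun k _ => hterm k
  have hη' : ∫ w, η w ∂P ≤ ε / 3 := by
    have h1 : ∫ w, η w ∂P = ∑ k ∈ Finset.range N, avgWeight ρ N k *
        (∫ w, inner ℝ (Gx (x k w) (y (k + 1) w) (ωx k w) - gradX Φ (x k w) (y (k + 1) w))
            (a - x (k + 1) w) ∂P
          - ∫ w, inner ℝ (Gy (x k w) (y k w) (ωy k w) - gradY Φ (x k w) (y k w))
            (b - y (k + 1) w) ∂P) := by
      rw [integral_finsetSum _ fun k _ => hterm k]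
      refine Finset.sum_congr rfl fun k _ => ?_
      rw [integral_const_mul, ← integral_sub (hX k).1 (hY k).1]
    rw [h1]
    refine (Finset.sum_le_sum fun k _ => mul_le_mul_of_nonneg_left
      (show _ ≤ ε / 3 by linarith [(hX k).2, (hY k).2]) (hw k)).trans ?_
    rw [← Finset.sum_mul, hw1, one_mul]
  have hsq := sum_avgWeight_sq_le hr.ρ_pos hr.ρ_lt_one hN
  have hT : 0 < 1 + tailRatio ρ N := by linarith
  have hBint : Integrable B P :=
    (((integrable_const _).add hη).const_mul _).add
      (((hMx.div_const _).add (hMy.div_const _)).const_mul _)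
  have hvar : ∀ {I δ μ : ℝ}, 0 < μ → I ≤ (∑ k ∈ Finset.range N, avgWeight ρ N k ^ 2) * δ ^ 2 →
      (1 - ρ) * δ ^ 2 / μ ≤ ε / 6 → (1 + tailRatio ρ N)⁻¹ * (I / μ) ≤ ε / 6 := by
    intro I δ μ hμ hI hδ
    refine le_trans ?_ hδ
    rw [inv_mul_le_iff₀ hT, div_le_iff₀ hμ]
    calc I ≤ (1 + tailRatio ρ N) * (1 - ρ) * δ ^ 2 :=
          hI.trans (mul_le_mul_of_nonneg_right hsq (sq_nonneg _))
      _ = _ := by field_simp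
  have hBle : ∫ w, B w ∂P ≤ ε := by
    have h1 : ∫ w, B w ∂P
        = 17 / 10 * (tailRatio ρ N / 2 * (μx * Ωf + μy * Ωg) + ∫ w, η w ∂P)
          + 17 / 14 * ((1 + tailRatio ρ N)⁻¹ * ((∫ w, Mx w ∂P) / μx)
            + (1 + tailRatio ρ N)⁻¹ * ((∫ w, My w ∂P) / μy)) := by
      have i1 : Integrable (fun w => 17 / 10 * (tailRatio ρ N / 2 * (μx * Ωf + μy * Ωg) + η w)) P :=
        ((integrable_const _).add hη).const_mul _
      have i2 : Integrable (fun w => 17 / 14 * (1 + tailRatio ρ N)⁻¹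
          * (Mx w / μx + My w / μy)) P :=
        ((hMx.div_const _).add (hMy.div_const _)).const_mul _
      rw [integral_add i1 i2, integral_const_mul, integral_const_mul,
        integral_add (integrable_const _) hη,
        integral_add (hMx.div_const _) (hMy.div_const _), integral_div, integral_div]
      simp only [integral_const, probReal_univ, one_smul]
      ring
    have h2 := hvar hμx hMx' hnx
    have h3 := hvar hμy hMy' hny
    -- The budget closes narrowly: `17/10 * (1/60 + 1/3) + 17/14 * (1/6 + 1/6) < 1`.
    rw [h1]
    linarith
  calc expectedGap P f g Φ (weightedAvg ρ x N) (weightedAvg ρ y N)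
      ≤ ∫⁻ w, ENNReal.ofReal (B w) ∂P := by
        refine lintegral_mono fun w => ?_
        rw [← EReal.real_coe_toENNReal, weightedAvg_eq, weightedAvg_eq]
        exact EReal.toENNReal_le_toENNReal
          (primalDualGap_le hS (hxmem w) (hymem w) (hgap w))
    _ = ENNReal.ofReal (∫ w, B w ∂P) :=
        (ofReal_integral_eq_lintegral_ofReal hBint (Filter.Eventually.of_forall hB0)).symm
    _ ≤ ENNReal.ofReal ε := ENNReal.ofReal_le_ofReal hBle

end Oracle
end SaddlePoint

theorem mainTheorem10 (β₁ β₂ : ℝ) (hβ₁ : β₁ ∈ Set.Ioo (0 : ℝ) 1) (hβ₂ : β₂ ∈ Set.Ioo (0 : ℝ) 1)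
    (hβ : β₁ + β₂ < 1) :
    ∃ C : ℝ, 0 < C ∧
      ∀ (E : Type*) [NormedAddCommGroup E] [InnerProductSpace ℝ E] [FiniteDimensional ℝ E]
        [CompleteSpace E] [MeasurableSpace E] [BorelSpace E]
        (F : Type*) [NormedAddCommGroup F] [InnerProductSpace ℝ F] [FiniteDimensional ℝ F]
        [CompleteSpace F] [MeasurableSpace F] [BorelSpace F]
        (S : Type*) [MeasurableSpace S] (T : Type*) [MeasurableSpace T]
        (Ω : Type*) [MeasurableSpace Ω] (P : Measure Ω) [IsProbabilityMeasure P]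
        (f : E → EReal) (g : F → EReal) (Φ : E → F → ℝ)
        (μx μy Lxx Lxy Lyx Lyy Ωf Ωg δx δy ε τ σ ρ : ℝ)
        (Gx : E → F → S → E) (Gy : E → F → T → F) (ωx : ℕ → Ω → S) (ωy : ℕ → Ω → T)
        (x₀ : E) (y₀ : F) (x : ℕ → Ω → E) (y : ℕ → Ω → F),
        0 < μx → 0 < μy → 0 < ε →
        SaddlePoint.IsSmoothSaddle f g Φ μx μy Lxx Lxy Lyx Lyy →
        SaddlePoint.HasCompactDomains f g Ωf Ωg →
        x₀ ∈ SaddlePoint.effDom f → y₀ ∈ SaddlePoint.effDom g →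
        ρ = SaddlePoint.rhoSGDA β₁ β₂ μx μy Lxx Lyx Lyy δx δy ε →
        τ = (1 - ρ) / (μx * ρ) →
        σ = 1 / (1 - β₁ - β₂) * ((1 - ρ) / (μy * ρ)) →
        x = SaddlePoint.sapdX f g Gx Gy τ σ 0 x₀ y₀ ωx ωy →
        y = SaddlePoint.sapdY f g Gx Gy τ σ 0 x₀ y₀ ωx ωy →
        SaddlePoint.IsUnbiasedOracle P Φ Gx Gy ωx ωy x y δx δy →
        ∀ N : ℕ, 1 ≤ N →
          C * (1 + Lxx / μx + Lyx ^ 2 / (μx * μy) + Lyy ^ 2 / μy ^ 2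
              + (δx ^ 2 / μx + δy ^ 2 / μy) * (1 / ε))
            * Real.log ((μx * Ωf + μy * Ωg) / ε + 1) ≤ N →
          SaddlePoint.expectedGap P f g Φ
            (SaddlePoint.weightedAvg ρ x N) (SaddlePoint.weightedAvg ρ y N)
            ≤ ENNReal.ofReal ε := by
  obtain ⟨hβ₁0, -⟩ := hβ₁
  obtain ⟨hβ₂0, -⟩ := hβ₂
  have hc : 0 < 1 - β₁ - β₂ := by linarith
  -- The factor `30` brings the initial error down to `t W ≤ ε / 30`, the slack left by the noise
  -- terms.
  refine ⟨30 * SaddlePoint.complexityConst β₁ β₂, ?_, ?_⟩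
  · rw [SaddlePoint.complexityConst]
    positivity
  intro E _ _ _ _ _ _ F _ _ _ _ _ _ S _ T _ Ω _ P _ f g Φ μx μy Lxx Lxy Lyx Lyy Ωf Ωg δx δy ε
    τ σ ρ Gx Gy ωx ωy x₀ y₀ x y hμx hμy hε hS hcd hx₀ hy₀ hρ hτ hσ hx hy hO N hN hcomp
  have hr := SaddlePoint.isStepRule_rhoSGDA hβ₁0 hβ₂0 hβ hμx hμy hε hS.Lxx_nonneg hS.Lyx_pos
    hρ hτ hσ
  have hM := SaddlePoint.one_le_one_sub_rhoSGDA_mul (Lyy := Lyy) (δx := δx) (δy := δy)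
    hβ₁0 hβ₂0 hβ hμx hμy hε hS.Lxx_nonneg hS.Lyx_pos
  rw [← hρ] at hM
  have hρx : SaddlePoint.rhoNoiseX μx δx ε ≤ ρ :=
    hρ ▸ (le_max_left _ _).trans (le_max_right _ _)
  have hρy : SaddlePoint.rhoNoiseY β₁ β₂ μy δy ε ≤ ρ :=
    hρ ▸ (le_max_right _ _).trans (le_max_right _ _)
  have hρ0 := hr.ρ_pos
  have hρ1 := hr.ρ_lt_one
  have hnx := SaddlePoint.noiseX_le hμx hε hρx
  have hny := SaddlePoint.noiseY_le hβ₁0 hβ₂0 hβ hμy hε hρ0.le hρ1.le hρy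
  have hrun : SaddlePoint.IsSGDARun f g Gx Gy τ σ x₀ y₀ ωx ωy x y := by
    rw [hx, hy]
    exact SaddlePoint.isSGDARun_sapd f g Gx Gy τ σ x₀ y₀ ωx ωy
  -- Properness supplies the second countability required by the measurability lemmas.
  have : ProperSpace E := FiniteDimensional.proper ℝ E
  have : ProperSpace F := FiniteDimensional.proper ℝ F
  refine SaddlePoint.expectedGap_le hS hr hcd hx₀ hy₀ hO hrun hN hε ?_ hnx hny ?_ ?_
  · refine SaddlePoint.tailRatio_mul_le hρ0 hρ1 hN hε ?_ hM ?_
    · have := hcd.Ωf_pos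
      have := hcd.Ωg_pos
      positivity
    · rw [SaddlePoint.complexityNumber, ← mul_assoc]
      exact hcomp
  -- Here `τ / (1 + τ μx) = (1 - ρ) / μx`, so both noise conditions in `x` coincide.
  · refine le_trans (le_of_eq ?_) hnx
    rw [hr.one_add_τ_mul, hτ]
    field_simp
  · have h := SaddlePoint.noiseY_mul_le hβ hμy hε hρ1.le hρy
    have hden : 0 < 1 - (β₁ + β₂) * ρ := by
      have : (β₁ + β₂) * ρ < 1 := by
        calc (β₁ + β₂) * ρ ≤ (β₁ + β₂) * 1 := by gcongr
          _ < 1 := by linarith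
      linarith
    -- The step `σ` is calibrated to the modulus `(1 - β₁ - β₂) μy`, while the proximal map
    -- contracts with the full `μy`. This mismatch produces the factor `1 - (β₁ + β₂) ρ`.
    have e : σ / (1 + σ * μy) = (1 - ρ) / (μy * (1 - (β₁ + β₂) * ρ)) := by
      have e1 : 1 + σ * μy = (1 - (β₁ + β₂) * ρ) / ((1 - β₁ - β₂) * ρ) := by
        rw [hσ]
        field_simp
        ring
      rw [e1, hσ]
      field_simp
    rw [e, div_mul_eq_mul_div, div_le_iff₀ (by positivity)]
    linarith
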